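/- Let $d\ge 5$ be an integer, let $\frac{2d}{d-4}<p\le\infty$ (with $d/p=0$ if $p=\infty$), and let $\mathbb T^d=\mathbb R^d/\mathbb Z^d$ with its normalized Lebesgue measure. For $f\in L^2(\mathbb T^d)$ and $\mathbf k\in\mathbb Z^d$ write $\mathcal F(f)(\mathbf k)=\int_{\mathbb T^d}f(x)e^{-2\pi i\mathbf k\cdot x}\,dx$, and for $R,\delta>0$ let $$P_{R,\delta}f(x)=\sum_{\mathbf k\in\mathbb Z^d,\ R-\delta/2\le|\mathbf k|\le R+\delta/2}\mathcal F(f)(\mathbf k)\,e^{2\pi i\mathbf k\cdot x}$$ be the spectral projector onto the frequencies in the annulus of radius $R$ and width $\delta$ ($|\cdot|$ is the Euclidean norm). Then for every $A\ge1$ there is a constant $C$, depending only on $d$, $p$ and $A$, such that for all real $N\ge1$, all $R$ with $N/A\le R\le AN$, all $\delta$ with $\frac1{AN}\le\delta\le1$, and all $f\in L^2(\mathbb T^d)$, $$\|P_{R,\delta}f\|_{L^p(\mathbb T^d)}\le C\,N^{\frac{d-1}{2}-\frac dp}\,\delta^{1/2}\,\|f\|_{L^2(\mathbb T^d)}.$$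 -/

import Mathlib

open MeasureTheory
open scoped ENNReal

noncomputable section

/-- The Euclidean length `|k|` of an integer vector `k`. -/
def latticeNorm {d : ℕ} (k : Fin d → ℤ) : ℝ :=
  Real.sqrt (∑ i, (k i : ℝ) ^ 2)

/-- The integer vectors in the closed annulus of (mid-)radius `R` and width `δ`,
i.e. those with `R - δ / 2 ≤ |k| ≤ R + δ / 2`. -/
def annulus (d : ℕ) (R δ : ℝ) : Set (Fin d → ℤ) :=
  {k | |latticeNorm k - R| ≤ δ / 2}

theorem annulus_finite (d : ℕ) (R δ : ℝ) : (annulus d R δ).Finite := by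
  obtain ⟨M, hM⟩ := exists_nat_ge (R + δ / 2)
  refine (Set.Finite.pi' (fun _ : Fin d => Set.finite_Icc (-(M : ℤ)) (M : ℤ))).subset ?_
  intro k hk i
  have h1 : latticeNorm k ≤ M := by
    have := (abs_le.mp (show |latticeNorm k - R| ≤ δ / 2 from hk)).2
    linarith
  have h2 : |(k i : ℝ)| ≤ latticeNorm k := by
    rw [← Real.sqrt_sq_eq_abs]
    exact Real.sqrt_le_sqrt
      (Finset.single_le_sum (f := fun j => (k j : ℝ) ^ 2) (fun j _ => sq_nonneg _)
        (Finset.mem_univ i))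
  have h3 := abs_le.mp (h2.trans h1)
  exact ⟨by exact_mod_cast h3.1, by exact_mod_cast h3.2⟩

/-- The spectral projector onto the frequencies in the annulus of radius `R` and width `δ`:
`x ↦ ∑ k, 𝓕(f)(k) e(k · x)`, the sum being over the integer vectors `k` in the annulus.
Here `UnitAddTorus (Fin d)` is `ℝ^d / ℤ^d` with its Haar probability measure. -/
def specProj {d : ℕ} (R δ : ℝ) (f : UnitAddTorus (Fin d) → ℂ) : UnitAddTorus (Fin d) → ℂ :=
  fun x => ∑ k ∈ (annulus_finite d R δ).toFinset,
    UnitAddTorus.mFourierCoeff f k * UnitAddTorus.mFourier k x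

end

/-! The argument is a restricted Stein–Tomas argument combined with Weyl's inequality. By duality,
the level sets of `specProj R δ f` are controlled by ∑ |ĝ(k)|² over the annulus, for |g| ≤ 1_E. On
the annulus |k|² lies in an interval containing O(Nδ) integers (this uses δ ≳ 1/N), and each sphere
|k|² = n is singled out by a Fourier integral in t. It therefore suffices to bound the integral over
[0,1] of |Q(t)|, where Q(t) = ∑ w(k)|ĝ(k)|² e(t|k|²) and w is a product of tents at scale L ~ N.

For fixed t there are two bounds. The kernel of this quadratic form is a product of d
one-dimensional Weyl sums, so a bound B for these, uniform in the linear phase, gives |Q| ≤ B^d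
|E|². Bessel's inequality gives |Q| ≤ L^d |E|. Their weighted geometric mean is L^(d-s) B^s
|E|^(1+θ) with s = dθ.

Smooth weights give Weyl's inequality without a logarithm: B² ≲ L⁴ / (q max(1, L²|2t - a/q|))
(`exists_rational_norm_weylSum_sq_le`). Integrating B^s over t and summing over a and q leaves ∑
q^(1-s/2), which converges exactly when s > 4 (`exists_integral_norm_le_of_weylSum_bound`). This is
the 4 in 2d/(d-4).

The outcome (`exists_sum_annulus_sq_mFourierCoeff_le`) is a weak-type bound with exponent r =
2/(1-θ), where θ > 4/d. The same method with constant coefficients counts the lattice points of the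
annulus and so bounds the supremum. Integrating the weak-type bound over levels up to the supremum
(`lintegral_rpow_le_of_weak_bound`) gives L^p for finite p > r, and such a θ exists exactly when p >
2d/(d-4). -/

/-! ### The additive character -/

/-- The character `e(y) = exp(2πiy)`. -/
noncomputable def unitExp (y : ℝ) : ℂ := Complex.exp (Complex.I * ((2 * Real.pi * y : ℝ) : ℂ))

theorem unitExp_add (x y : ℝ) : unitExp (x + y) = unitExp x * unitExp y := by
  simp only [unitExp, ← Complex.exp_add]
  congr 1
  push_cast
  ring

theorem norm_unitExp (y : ℝ) : ‖unitExp y‖ = 1 := by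
  rw [unitExp, mul_comm, Complex.norm_exp_ofReal_mul_I]

theorem unitExp_ne_zero (y : ℝ) : unitExp y ≠ 0 := Complex.exp_ne_zero _

theorem unitExp_intCast (n : ℤ) : unitExp n = 1 := by
  rw [unitExp, Complex.exp_eq_one_iff]
  exact ⟨n, by push_cast; ring⟩

theorem unitExp_zero : unitExp 0 = 1 := by simp [unitExp]

theorem conj_unitExp (y : ℝ) : (starRingEnd ℂ) (unitExp y) = unitExp (-y) := by
  rw [unitExp, unitExp, ← Complex.exp_conj]
  congr 1
  rw [map_mul, Complex.conj_I, Complex.conj_ofReal]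
  push_cast
  ring

theorem unitExp_int_mul (l : ℤ) (y : ℝ) : unitExp (l * y) = unitExp y ^ l := by
  rw [unitExp, unitExp, ← Complex.exp_int_mul]
  congr 1
  push_cast
  ring

theorem continuous_unitExp : Continuous unitExp := by
  unfold unitExp
  fun_prop

/-- By periodicity y may be reduced to |r| ≤ 1/2, where |e(r) - 1| = 2|sin πr| and Jordan's
inequality applies. -/
theorem four_mul_abs_sub_round_le_norm_unitExp_sub_one (y : ℝ) :
    4 * |y - round y| ≤ ‖unitExp y - 1‖ := by
  set r := y - round y with hr
  have hy : unitExp y = unitExp r := by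
    have : y = r + (round y : ℤ) := by rw [hr]; ring
    conv_lhs => rw [this]
    rw [unitExp_add, unitExp_intCast, mul_one]
  rw [hy, unitExp, Complex.norm_exp_I_mul_ofReal_sub_one]
  have h1 : |r| ≤ 1 / 2 := abs_sub_round y
  have h2 : 2 * Real.pi * r / 2 = Real.pi * r := by ring
  rw [h2, norm_mul, Real.norm_eq_abs, Real.norm_eq_abs, abs_two]
  have h3 : 2 * |r| ≤ |Real.sin (Real.pi * r)| := by
    have h4 : |Real.sin (Real.pi * r)| = |Real.sin (Real.pi * |r|)| := by
      rcases abs_choice r with h | h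
      · rw [h]
      · rw [h, mul_neg, Real.sin_neg, abs_neg]
    rw [h4]
    have h5 := Real.mul_le_sin (x := Real.pi * |r|) (by positivity)
      (by nlinarith [Real.pi_pos])
    have h6 : 2 / Real.pi * (Real.pi * |r|) = 2 * |r| := by
      field_simp
    rw [h6] at h5
    exact h5.trans (le_abs_self _)
  linarith

/-! ### Tent weights, their correlations and summation by parts -/

/-- The (unnormalized) tent function on the integers, supported on `|k| < L`. -/
def tent (L : ℕ) (k : ℤ) : ℤ := max 0 (min (L - k) (L + k))

theorem tent_nonneg (L : ℕ) (k : ℤ) : 0 ≤ tent L k := le_max_left _ _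

theorem tent_le (L : ℕ) (k : ℤ) : tent L k ≤ L := by
  unfold tent
  omega

theorem tent_eq_zero {L : ℕ} {k : ℤ} (h : k ∉ Finset.Ioo (-(L : ℤ)) L) : tent L k = 0 := by
  simp only [Finset.mem_Ioo, not_and_or, not_lt] at h
  unfold tent
  omega

theorem abs_tent_succ_sub_le (L : ℕ) (k : ℤ) : |tent L (k + 1) - tent L k| ≤ 1 := by
  rw [abs_le]
  unfold tent
  omega

theorem abs_tent_pred_sub_le (L : ℕ) (k : ℤ) : |tent L (k - 1) - tent L k| ≤ 1 := by
  rw [abs_le]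
  unfold tent
  omega

/-- The tent is piecewise linear, with kinks only at -L, 0 and L. -/
theorem abs_tent_second_difference_le (L : ℕ) (k : ℤ) :
    |tent L (k - 1) - 2 * tent L k + tent L (k + 1)| ≤
      if k ∈ ({-(L : ℤ), 0, (L : ℤ)} : Finset ℤ) then 2 else 0 := by
  split_ifs with h
  · rw [abs_le]
    unfold tent
    omega
  · simp only [Finset.mem_insert, Finset.mem_singleton, not_or] at h
    rw [abs_le]
    unfold tent
    omega

/-- The correlation `tent(l) tent(l + m)`. -/
def tentCorr (L : ℕ) (m l : ℤ) : ℤ := tent L l * tent L (l + m)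

theorem tentCorr_eq_zero {L : ℕ} {m l : ℤ} (h : l ∉ Finset.Ioo (-(L : ℤ)) L) :
    tentCorr L m l = 0 := by
  simp [tentCorr, tent_eq_zero h]

/-- Discrete Leibniz rule: each second difference meets a factor of size at most L, and the two
products of first differences contribute at most 1 each. -/
theorem abs_tentCorr_second_difference_le (L : ℕ) (m l : ℤ) :
    |tentCorr L m (l - 1) - 2 * tentCorr L m l + tentCorr L m (l + 1)| ≤
      L * (if l ∈ ({-(L : ℤ), 0, (L : ℤ)} : Finset ℤ) then 2 else 0) +
      L * (if l + m ∈ ({-(L : ℤ), 0, (L : ℤ)} : Finset ℤ) then 2 else 0) + 2 := by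
  have e1 : l - 1 + m = l + m - 1 := by ring
  have e2 : l + 1 + m = l + m + 1 := by ring
  have hf := abs_tent_second_difference_le L l
  have hg := abs_tent_second_difference_le L (l + m)
  have a1 := abs_tent_succ_sub_le L l
  have a2 := abs_tent_pred_sub_le L l
  have b1 := abs_tent_succ_sub_le L (l + m)
  have b2 := abs_tent_pred_sub_le L (l + m)
  have key : tentCorr L m (l - 1) - 2 * tentCorr L m l + tentCorr L m (l + 1) =
      tent L (l + m) * (tent L (l - 1) - 2 * tent L l + tent L (l + 1)) +
      tent L l * (tent L (l + m - 1) - 2 * tent L (l + m) + tent L (l + m + 1)) +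
      ((tent L (l + 1) - tent L l) * (tent L (l + m + 1) - tent L (l + m)) +
      (tent L (l - 1) - tent L l) * (tent L (l + m - 1) - tent L (l + m))) := by
    simp only [tentCorr, e1, e2]
    ring
  rw [key]
  refine (abs_add_three _ _ _).trans (add_le_add (add_le_add ?_ ?_)
    ((abs_add_le _ _).trans ?_))
  · rw [abs_mul, abs_of_nonneg (tent_nonneg _ _)]
    exact mul_le_mul (tent_le _ _) hf (abs_nonneg _) (by positivity)
  · rw [abs_mul, abs_of_nonneg (tent_nonneg _ _)]
    exact mul_le_mul (tent_le _ _) hg (abs_nonneg _) (by positivity)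
  · rw [abs_mul, abs_mul]
    nlinarith [mul_le_one₀ a1 (abs_nonneg _) b1, mul_le_one₀ a2 (abs_nonneg _) b2]

theorem sum_abs_tentCorr_second_difference_le {L : ℕ} (hL : 1 ≤ L) (m : ℤ) :
    ∑ l ∈ Finset.Icc (-(L : ℤ)) L,
      |tentCorr L m (l - 1) - 2 * tentCorr L m l + tentCorr L m (l + 1)| ≤ 18 * L := by
  have hcount : ∀ c : ℤ, ∑ l ∈ Finset.Icc (-(L : ℤ)) L,
      (L : ℤ) * (if l + c ∈ ({-(L : ℤ), 0, (L : ℤ)} : Finset ℤ) then 2 else 0) ≤ 6 * L := by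
    intro c
    rw [← Finset.mul_sum, ← Finset.sum_filter, Finset.sum_const]
    have h1 : ((Finset.Icc (-(L : ℤ)) L).filter
        (fun l => l + c ∈ ({-(L : ℤ), 0, (L : ℤ)} : Finset ℤ))).card ≤ 3 := by
      refine (Finset.card_le_card_of_injOn (t := ({-(L : ℤ), 0, (L : ℤ)} : Finset ℤ))
        (fun l => l + c) (fun l hl => (Finset.mem_filter.mp hl).2)
        (fun a _ b _ h => by simpa using h)).trans Finset.card_le_three
    have h2 : (((Finset.Icc (-(L : ℤ)) L).filter
        (fun l => l + c ∈ ({-(L : ℤ), 0, (L : ℤ)} : Finset ℤ))).card : ℤ) ≤ 3 := by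
      exact_mod_cast h1
    rw [nsmul_eq_mul]
    have h3 : (1 : ℤ) ≤ L := by exact_mod_cast hL
    nlinarith
  have h0 := hcount 0
  have hm := hcount m
  simp only [add_zero] at h0
  calc _ ≤ ∑ l ∈ Finset.Icc (-(L : ℤ)) L,
      ((L : ℤ) * (if l ∈ ({-(L : ℤ), 0, (L : ℤ)} : Finset ℤ) then 2 else 0) +
      L * (if l + m ∈ ({-(L : ℤ), 0, (L : ℤ)} : Finset ℤ) then 2 else 0) + 2) :=
        Finset.sum_le_sum fun l _ => abs_tentCorr_second_difference_le L m l
    _ ≤ 18 * L := by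
      rw [Finset.sum_add_distrib, Finset.sum_add_distrib, Finset.sum_const, Int.card_Icc,
        nsmul_eq_mul]
      have h3 : (1 : ℤ) ≤ L := by exact_mod_cast hL
      have h4 : (((L : ℤ) + 1 - -(L : ℤ)).toNat : ℤ) = 2 * L + 1 := by omega
      rw [h4]
      linarith

/-- Summation by parts, twice, for a sequence supported on `|l| < L`. -/
theorem sum_second_difference_mul_zpow {L : ℕ} {h : ℤ → ℂ}
    (hh : ∀ l, l ∉ Finset.Ioo (-(L : ℤ)) L → h l = 0) {z : ℂ} (hz : z ≠ 0) :
    ∑ l ∈ Finset.Icc (-(L : ℤ)) L, (h (l - 1) - 2 * h l + h (l + 1)) * z ^ l =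
      (z - 1) ^ 2 * z⁻¹ * ∑ l ∈ Finset.Icc (-(L : ℤ)) L, h l * z ^ l := by
  -- Since h lives on the open interval, its shifts by ±1 remain supported in [-L, L], so no
  -- boundary terms appear.
  have hsupp : ∀ (c : ℤ), |c| ≤ 1 → ∑ l ∈ Finset.Icc (-(L : ℤ)) L, h (l + c) * z ^ l =
      z ^ (-c) * ∑ l ∈ Finset.Icc (-(L : ℤ)) L, h l * z ^ l := by
    intro c hc
    rw [Finset.mul_sum]
    have e1 : ∑ l ∈ Finset.Icc (-(L : ℤ)) L, h (l + c) * z ^ l =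
        ∑ᶠ l : ℤ, h (l + c) * z ^ l := by
      refine (finsum_eq_sum_of_support_subset _ ?_).symm
      intro l hl
      by_contra hn
      refine hl ?_
      rw [abs_le] at hc
      have : h (l + c) = 0 := hh _ (by
        simp only [Finset.coe_Icc, Set.mem_Icc, Finset.mem_Ioo] at hn ⊢
        omega)
      simp [this]
    have e2 : ∑ l ∈ Finset.Icc (-(L : ℤ)) L, z ^ (-c) * (h l * z ^ l) =
        ∑ᶠ l : ℤ, z ^ (-c) * (h l * z ^ l) := by
      refine (finsum_eq_sum_of_support_subset _ ?_).symm
      intro l hl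
      by_contra hn
      refine hl ?_
      have : h l = 0 := hh _ (by
        simp only [Finset.coe_Icc, Set.mem_Icc, Finset.mem_Ioo] at hn ⊢
        omega)
      simp [this]
    rw [e1, e2]
    refine finsum_eq_of_bijective (fun l => l + c) (Equiv.addRight c).bijective ?_
    intro l
    rw [mul_left_comm, ← zpow_add₀ hz]
    congr 2
    ring
  have h1 := hsupp (-1) (by simp)
  have h2 := hsupp 1 (by simp)
  simp only [← sub_eq_add_neg, neg_neg, zpow_one, zpow_neg] at h1 h2
  have : ∀ l : ℤ, (h (l - 1) - 2 * h l + h (l + 1)) * z ^ l =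
      h (l - 1) * z ^ l - 2 * (h l * z ^ l) + h (l + 1) * z ^ l := fun l => by ring
  simp only [this, Finset.sum_add_distrib, Finset.sum_sub_distrib, ← Finset.mul_sum, h1, h2]
  field_simp
  ring

/-- Combines the trivial bound 3L³ with the bound from two summations by parts. The resulting
inverse-square decay in the distance to the nearest integer is summable, which is what avoids the
logarithm of sharp cutoffs. -/
theorem norm_sum_tentCorr_mul_unitExp_le {L : ℕ} (hL : 1 ≤ L) (m : ℤ) (y : ℝ) :
    ‖∑ l ∈ Finset.Icc (-(L : ℤ)) L, (tentCorr L m l : ℂ) * unitExp y ^ l‖ *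
      (1 + (L * (y - round y)) ^ 2) ≤ 5 * (L : ℝ) ^ 3 := by
  have hL' : (1 : ℝ) ≤ L := by exact_mod_cast hL
  set T := ∑ l ∈ Finset.Icc (-(L : ℤ)) L, (tentCorr L m l : ℂ) * unitExp y ^ l with hT
  have hT1 : ‖T‖ ≤ 3 * (L : ℝ) ^ 3 := by
    refine (norm_sum_le _ _).trans ?_
    refine (Finset.sum_le_card_nsmul _ _ ((L : ℝ) ^ 2) ?_).trans ?_
    · intro l _
      rw [norm_mul, norm_zpow, norm_unitExp, one_zpow, mul_one, tentCorr]
      have h1 : (0 : ℝ) ≤ tent L l := by exact_mod_cast tent_nonneg L l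
      have h2 : (0 : ℝ) ≤ tent L (l + m) := by exact_mod_cast tent_nonneg L (l + m)
      have h3 : (tent L l : ℝ) ≤ L := by exact_mod_cast tent_le L l
      have h4 : (tent L (l + m) : ℝ) ≤ L := by exact_mod_cast tent_le L (l + m)
      rw [Complex.norm_intCast]
      push_cast
      rw [abs_of_nonneg (by positivity)]
      nlinarith
    · rw [Int.card_Icc, nsmul_eq_mul]
      have h4 : (((L : ℤ) + 1 - -(L : ℤ)).toNat : ℤ) = 2 * L + 1 := by omega
      have h5 : (((L : ℤ) + 1 - -(L : ℤ)).toNat : ℝ) = 2 * L + 1 := by exact_mod_cast h4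
      rw [h5]
      nlinarith [sq_nonneg (L : ℝ)]
  have hT2 : ‖unitExp y - 1‖ ^ 2 * ‖T‖ ≤ 18 * L := by
    have hp := sum_second_difference_mul_zpow (L := L) (h := fun l => (tentCorr L m l : ℂ))
      (fun l hl => by simp [tentCorr_eq_zero hl]) (unitExp_ne_zero y)
    have hn := congrArg norm hp
    rw [norm_mul, norm_mul, norm_pow, norm_inv, norm_unitExp, inv_one, mul_one, ← hT] at hn
    rw [← hn]
    refine (norm_sum_le _ _).trans ?_
    have hs := sum_abs_tentCorr_second_difference_le hL m
    have hs' : (∑ l ∈ Finset.Icc (-(L : ℤ)) L,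
      |((tentCorr L m (l - 1) - 2 * tentCorr L m l + tentCorr L m (l + 1) : ℤ) : ℝ)|) ≤
        18 * L := by exact_mod_cast hs
    refine le_trans (le_of_eq (Finset.sum_congr rfl fun l _ => ?_)) hs'
    rw [norm_mul, norm_zpow, norm_unitExp, one_zpow, mul_one, ← Complex.norm_intCast]
    push_cast
    rfl
  have hr := four_mul_abs_sub_round_le_norm_unitExp_sub_one y
  have hr2 : 16 * (y - round y) ^ 2 ≤ ‖unitExp y - 1‖ ^ 2 := by
    rw [← sq_abs (y - round y)]
    nlinarith [abs_nonneg (y - round y)]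
  have hT3 : 16 * (y - round y) ^ 2 * ‖T‖ ≤ 18 * L :=
    (mul_le_mul_of_nonneg_right hr2 (norm_nonneg _)).trans hT2
  have : ‖T‖ * (1 + (L * (y - round y)) ^ 2) =
      ‖T‖ + (L : ℝ) ^ 2 * (16 * (y - round y) ^ 2 * ‖T‖) / 16 := by ring
  rw [this]
  have h6 : (L : ℝ) ^ 2 * (16 * (y - round y) ^ 2 * ‖T‖) ≤ (L : ℝ) ^ 2 * (18 * L) :=
    mul_le_mul_of_nonneg_left hT3 (by positivity)
  nlinarith [pow_pos (lt_of_lt_of_le one_pos hL') 3]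

/-! ### Weyl differencing and Weyl's inequality -/

/-- The one-dimensional quadratic Weyl sum with tent weights. -/
noncomputable def weylSum (L : ℕ) (t : ℝ) (z : ℂ) : ℂ :=
  ∑ k ∈ Finset.Icc (-(L : ℤ)) L, (tent L k : ℂ) * unitExp (t * (k : ℝ) ^ 2) * z ^ k

/-- Weyl differencing with k = l + m. The linear phase contributes only z^m, of modulus 1, so the
bound is uniform in z; the quadratic phase becomes linear in l with frequency 2tm. -/
theorem norm_weylSum_sq_le (L : ℕ) (t : ℝ) {z : ℂ} (hz : ‖z‖ = 1) :
    ‖weylSum L t z‖ ^ 2 ≤ ∑ m ∈ Finset.Icc (-(2 * L : ℤ)) (2 * L),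
      ‖∑ l ∈ Finset.Icc (-(L : ℤ)) L, (tentCorr L m l : ℂ) * unitExp (m * (2 * t)) ^ l‖ := by
  have hz0 : z ≠ 0 := fun h => by simp [h] at hz
  set φ : ℤ → ℂ := fun k => (tent L k : ℂ) * unitExp (t * (k : ℝ) ^ 2) * z ^ k with hφ
  have hφ0 : ∀ k, k ∉ Finset.Icc (-(L : ℤ)) L → φ k = 0 := fun k hk => by
    have : tent L k = 0 := tent_eq_zero (fun h => hk (Finset.Ioo_subset_Icc_self h))
    simp [hφ, this]
  have hshift : ∀ l ∈ Finset.Icc (-(L : ℤ)) L, ∑ k ∈ Finset.Icc (-(L : ℤ)) L, φ k =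
      ∑ m ∈ Finset.Icc (-(2 * L : ℤ)) (2 * L), φ (l + m) := by
    intro l hl
    rw [Finset.mem_Icc] at hl
    have h1 : ∑ m ∈ Finset.Icc (-(2 * L : ℤ)) (2 * L), φ (l + m) =
        ∑ k ∈ Finset.Icc (l + -(2 * L : ℤ)) (l + 2 * L), φ k := by
      rw [← Finset.map_add_left_Icc, Finset.sum_map]
      simp
    rw [h1]
    refine Finset.sum_subset (Finset.Icc_subset_Icc (by omega) (by omega)) ?_
    intro k _ hk
    exact hφ0 k hk
  have hconj : (starRingEnd ℂ) z = z⁻¹ := by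
    rw [Complex.inv_def, Complex.normSq_eq_norm_sq, hz]
    simp
  have key : (weylSum L t z) * (starRingEnd ℂ) (weylSum L t z) =
      ∑ m ∈ Finset.Icc (-(2 * L : ℤ)) (2 * L), (unitExp (t * (m : ℝ) ^ 2) * z ^ m) *
        ∑ l ∈ Finset.Icc (-(L : ℤ)) L, (tentCorr L m l : ℂ) * unitExp (m * (2 * t)) ^ l := by
    have h1 : (starRingEnd ℂ) (weylSum L t z) =
        ∑ l ∈ Finset.Icc (-(L : ℤ)) L, (starRingEnd ℂ) (φ l) := by
      rw [weylSum, map_sum]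
    rw [h1, Finset.mul_sum]
    have h2 : ∀ l ∈ Finset.Icc (-(L : ℤ)) L, weylSum L t z * (starRingEnd ℂ) (φ l) =
        ∑ m ∈ Finset.Icc (-(2 * L : ℤ)) (2 * L), φ (l + m) * (starRingEnd ℂ) (φ l) := by
      intro l hl
      rw [← Finset.sum_mul, ← hshift l hl]
      rfl
    rw [Finset.sum_congr rfl h2, Finset.sum_comm]
    refine Finset.sum_congr rfl fun m _ => ?_
    rw [Finset.mul_sum]
    refine Finset.sum_congr rfl fun l _ => ?_
    simp only [hφ, map_mul, map_zpow₀, conj_unitExp, hconj, map_intCast, tentCorr]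
    have h3 : unitExp (t * ((l + m : ℤ) : ℝ) ^ 2) * unitExp (-(t * (l : ℝ) ^ 2)) =
        unitExp (t * (m : ℝ) ^ 2) * unitExp (m * (2 * t)) ^ l := by
      rw [← unitExp_int_mul, ← unitExp_add, ← unitExp_add]
      congr 1
      push_cast
      ring
    have h4 : z ^ (l + m) * z⁻¹ ^ l = z ^ m := by
      rw [zpow_add₀ hz0, inv_zpow]
      field_simp
    push_cast
    calc _ = (tent L l : ℂ) * (tent L (l + m)) *
        (unitExp (t * ((l + m : ℤ) : ℝ) ^ 2) * unitExp (-(t * (l : ℝ) ^ 2))) *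
        (z ^ (l + m) * z⁻¹ ^ l) := by push_cast; ring
      _ = _ := by rw [h3, h4]; ring
  have hnorm := congrArg norm key
  rw [norm_mul, RCLike.norm_conj, ← sq] at hnorm
  rw [hnorm]
  refine (norm_sum_le _ _).trans (Finset.sum_le_sum fun m _ => ?_)
  rw [norm_mul, norm_mul, norm_unitExp, norm_zpow, hz, one_zpow, one_mul, one_mul]

/-- If `a / q` is in lowest terms and `|qu - a| < 1 / L`, then few integers `m` with `|m| ≤ 4L`
have `mu` within `1 / L` of an integer. -/
theorem card_near_integer_le {L : ℕ} (hL : 1 ≤ L) {u lam : ℝ} {q : ℕ} {a : ℤ} (hq : 1 ≤ q)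
    (hcop : IsCoprime a (q : ℤ)) (hlam : lam ≤ 1) (hlam0 : 0 < lam)
    (h1 : (q : ℝ) ≤ lam * L) (h2 : L * |q * u - a| ≤ lam)
    (h3 : lam * L ≤ q ∨ lam ≤ L * |q * u - a|) :
    (((Finset.Icc (-(4 * L : ℤ)) (4 * L)).filter
      (fun m : ℤ => L * |m * u - round (m * u)| ≤ 1)).card : ℝ) ≤ 187 / lam := by
  set Z := (Finset.Icc (-(4 * L : ℤ)) (4 * L)).filter
      (fun m : ℤ => L * |m * u - round (m * u)| ≤ 1) with hZ
  have hL' : (1 : ℝ) ≤ L := by exact_mod_cast hL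
  have hL0 : (0 : ℝ) < L := by linarith
  have hq' : (1 : ℝ) ≤ q := by exact_mod_cast hq
  have hmem : ∀ m ∈ Z, |(m : ℝ)| ≤ 4 * L ∧ L * |m * u - round (m * u)| ≤ 1 := by
    intro m hm
    rw [hZ, Finset.mem_filter, Finset.mem_Icc] at hm
    refine ⟨?_, hm.2⟩
    rw [abs_le]
    exact ⟨by exact_mod_cast hm.1.1, by exact_mod_cast hm.1.2⟩
  -- D m = q(mu - round(mu)) - m(qu - a) is an integer of size at most 1 + 4, so it takes at most 11
  -- values. Each is taken at most 2K + 1 ≤ 17/λ times, whence 187/λ.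
  set D : ℤ → ℤ := fun m => m * a - round (m * u) * q with hD
  have hDle : ∀ m ∈ Z, D m ∈ Finset.Icc (-5 : ℤ) 5 := by
    intro m hm
    obtain ⟨hm1, hm2⟩ := hmem m hm
    have e : ((D m : ℤ) : ℝ) = q * (m * u - round (m * u)) - m * (q * u - a) := by
      simp only [hD]
      push_cast
      ring
    have hb : |((D m : ℤ) : ℝ)| ≤ 5 := by
      rw [e]
      refine (abs_sub _ _).trans ?_
      rw [abs_mul, abs_mul, abs_of_nonneg (by positivity : (0 : ℝ) ≤ q)]
      have k1 : (q : ℝ) * |m * u - round (m * u)| ≤ 1 := by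
        calc (q : ℝ) * |m * u - round (m * u)| ≤ L * |m * u - round (m * u)| :=
              mul_le_mul_of_nonneg_right (by nlinarith) (abs_nonneg _)
          _ ≤ 1 := hm2
      have k2 : |(m : ℝ)| * |q * u - a| ≤ 4 := by
        calc |(m : ℝ)| * |q * u - a| ≤ 4 * L * |q * u - a| :=
              mul_le_mul_of_nonneg_right hm1 (abs_nonneg _)
          _ ≤ 4 := by linarith
      linarith
    rw [abs_le] at hb
    rw [Finset.mem_Icc]
    exact ⟨by exact_mod_cast hb.1, by exact_mod_cast hb.2⟩
  set K : ℕ := ⌊8 / lam⌋₊ with hK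
  have hfiber : ∀ b ∈ Finset.Icc (-5 : ℤ) 5, (Z.filter (fun m => D m = b)).card ≤ 2 * K + 1 := by
    intro b _
    rcases (Z.filter (fun m => D m = b)).eq_empty_or_nonempty with h | ⟨m₀, hm₀⟩
    · simp [h]
    have hcard : (Finset.Icc (-(K : ℤ)) K).card = 2 * K + 1 := by
      rw [Int.card_Icc]; omega
    rw [← hcard]
    rw [Finset.mem_filter] at hm₀
    -- Within a fibre of D, coprimality makes (m, round(mu)) move along multiples of (q, a).
    have hdiv : ∀ m ∈ Z.filter (fun m => D m = b), ∃ r : ℤ, m - m₀ = r * q ∧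
        round (m * u) - round (m₀ * u) = r * a := by
      intro m hm
      rw [Finset.mem_filter] at hm
      have e : (m - m₀) * a = (round (m * u) - round (m₀ * u)) * q := by
        have := hm.2.trans hm₀.2.symm
        simp only [hD] at this
        linarith
      have hdvd : (q : ℤ) ∣ m - m₀ :=
        hcop.symm.dvd_of_dvd_mul_right ⟨round (m * u) - round (m₀ * u), by rw [e]; ring⟩
      obtain ⟨r, hr⟩ := hdvd
      refine ⟨r, by rw [hr]; ring, ?_⟩
      have hq0 : (q : ℤ) ≠ 0 := by positivity
      apply mul_right_cancel₀ hq0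
      rw [← e, hr]
      ring
    refine Finset.card_le_card_of_injOn (fun m => (m - m₀) / q) ?_ ?_
    · intro m hm
      obtain ⟨r, hr1, hr2⟩ := hdiv m hm
      have hq0 : (q : ℤ) ≠ 0 := by positivity
      simp only [hr1, Int.mul_ediv_cancel _ hq0]
      rw [Finset.mem_coe, Finset.mem_filter] at hm
      obtain ⟨a1, a2⟩ := hmem m hm.1
      obtain ⟨b1, b2⟩ := hmem m₀ hm₀.1
      have hr1' : ((m : ℝ) - m₀) = r * q := by exact_mod_cast hr1
      have hr2' : ((round (m * u) : ℝ) - round (m₀ * u)) = r * a := by exact_mod_cast hr2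
      -- If q ≥ λL, then r is limited by |m - m₀| ≤ 8L. Otherwise L|qu - a| ≥ λ, and r(qu - a) is a
      -- difference of two errors of size at most 1/L.
      have hrl : |(r : ℝ)| * lam ≤ 8 := by
        rcases h3 with h3 | h3
        · have : |(r : ℝ)| * q ≤ 8 * L := by
            have : |(r : ℝ) * q| ≤ 8 * L := by
              rw [← hr1']
              refine (abs_sub _ _).trans ?_
              linarith
            rwa [abs_mul, abs_of_nonneg (by positivity : (0 : ℝ) ≤ q)] at this
          have : |(r : ℝ)| * (lam * L) ≤ 8 * L :=
            (mul_le_mul_of_nonneg_left h3 (abs_nonneg _)).trans this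
          have : (|(r : ℝ)| * lam) * L ≤ 8 * L := by linarith
          exact le_of_mul_le_mul_right this hL0
        · have e : (r : ℝ) * (q * u - a) =
              (m * u - round (m * u)) - (m₀ * u - round (m₀ * u)) := by
            have : (r : ℝ) * (q * u - a) = (r * q) * u - r * a := by ring
            rw [this, ← hr1', ← hr2']
            ring
          have : L * (|(r : ℝ)| * |q * u - a|) ≤ 2 := by
            rw [← abs_mul, e]
            have := abs_sub (m * u - round (m * u)) (m₀ * u - round (m₀ * u))
            nlinarith
          calc |(r : ℝ)| * lam ≤ |(r : ℝ)| * (L * |q * u - a|) :=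
                mul_le_mul_of_nonneg_left h3 (abs_nonneg _)
            _ ≤ 8 := by linarith
      have hrK : r.natAbs ≤ K := by
        rw [hK, Nat.le_floor_iff (by positivity), Nat.cast_natAbs, le_div_iff₀ hlam0]
        push_cast
        exact hrl
      rw [Finset.coe_Icc, Set.mem_Icc]
      omega
    · intro m hm m' hm' h
      obtain ⟨r, hr1, -⟩ := hdiv m hm
      obtain ⟨r', hr1', -⟩ := hdiv m' hm'
      have hq0 : (q : ℤ) ≠ 0 := by positivity
      simp only [hr1, hr1', Int.mul_ediv_cancel _ hq0] at h
      rw [h, ← hr1'] at hr1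
      linarith
  have hcard := Finset.card_le_mul_card_image_of_maps_to hDle (2 * K + 1) hfiber
  have hcard' : (Z.card : ℝ) ≤ (2 * K + 1) * 11 := by
    have h11 : (Finset.Icc (-5 : ℤ) 5).card = 11 := by simp
    rw [h11] at hcard
    exact_mod_cast hcard
  have hKle : (K : ℝ) ≤ 8 / lam := Nat.floor_le (by positivity)
  have hone : 1 ≤ 1 / lam := by rw [le_div_iff₀ hlam0]; linarith
  have : 187 / lam = (2 * (8 / lam) + 1 / lam) * 11 := by ring
  rw [this]
  linarith

/-- The sum of `1 / (1 + j²)` over the integers. -/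
noncomputable def intInvSqSum : ℝ := ∑' j : ℤ, (1 + (j : ℝ) ^ 2)⁻¹

theorem summable_int_inv_one_add_sq : Summable fun j : ℤ => (1 + (j : ℝ) ^ 2)⁻¹ := by
  have h : Summable fun j : ℤ => 1 / (j : ℝ) ^ 2 := by
    rw [Real.summable_one_div_int_pow]
    norm_num
  refine Summable.of_norm_bounded_eventually h ?_
  have : ∀ᶠ j : ℤ in Filter.cofinite, j ≠ 0 := (Set.finite_singleton (0 : ℤ)).compl_mem_cofinite
  filter_upwards [this] with j hj
  have hj' : (j : ℝ) ≠ 0 := by exact_mod_cast hj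
  rw [Real.norm_of_nonneg (by positivity), ← one_div]
  exact one_div_le_one_div_of_le (by positivity) (by linarith)

theorem intInvSqSum_pos : 0 < intInvSqSum :=
  summable_int_inv_one_add_sq.tsum_pos (fun _ => by positivity) 0 (by norm_num)

/-- The m are grouped by the integer part of L(mu - round(mu)). Two members of one group differ by
an integer of size at most 4L counted in `card_near_integer_le`, so every group has at most 187/λ
elements. -/
theorem sum_inv_one_add_sq_round_le {L : ℕ} (hL : 1 ≤ L) {u lam : ℝ} {q : ℕ} {a : ℤ} (hq : 1 ≤ q)
    (hcop : IsCoprime a (q : ℤ)) (hlam : lam ≤ 1) (hlam0 : 0 < lam)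
    (h1 : (q : ℝ) ≤ lam * L) (h2 : L * |q * u - a| ≤ lam)
    (h3 : lam * L ≤ q ∨ lam ≤ L * |q * u - a|) :
    ∑ m ∈ Finset.Icc (-(2 * L : ℤ)) (2 * L), (1 + (L * (m * u - round (m * u))) ^ 2)⁻¹ ≤
      561 * intInvSqSum / lam := by
  have hL0 : (0 : ℝ) < L := by exact_mod_cast hL
  have hZ := card_near_integer_le hL hq hcop hlam hlam0 h1 h2 h3
  set x : ℤ → ℝ := fun m => L * (m * u - round (m * u)) with hx
  set I := Finset.Icc (-(2 * L : ℤ)) (2 * L) with hI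
  have hterm : ∀ m, (1 + (x m) ^ 2)⁻¹ ≤ 3 * (1 + (⌊x m⌋ : ℝ) ^ 2)⁻¹ := by
    intro m
    have f1 := Int.floor_le (x m)
    have f2 := Int.lt_floor_add_one (x m)
    rw [← div_eq_mul_inv, ← one_div, div_le_div_iff₀ (by positivity) (by positivity)]
    nlinarith [sq_nonneg (x m), sq_nonneg (2 * x m - ⌊x m⌋)]
  have hfiber : ∀ j : ℤ, ((I.filter (fun m => ⌊x m⌋ = j)).card : ℝ) ≤ 187 / lam := by
    intro j
    rcases (I.filter (fun m => ⌊x m⌋ = j)).eq_empty_or_nonempty with h | ⟨m₀, hm₀⟩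
    · rw [h]
      simp only [Finset.card_empty, Nat.cast_zero]
      positivity
    refine le_trans ?_ hZ
    rw [Finset.mem_filter, hI, Finset.mem_Icc] at hm₀
    have : (I.filter (fun m => ⌊x m⌋ = j)).card ≤ ((Finset.Icc (-(4 * L : ℤ)) (4 * L)).filter
        (fun m : ℤ => L * |m * u - round (m * u)| ≤ 1)).card := by
      refine Finset.card_le_card_of_injOn (fun m => m - m₀) ?_ (fun a _ b _ h => by simpa using h)
      intro m hm
      rw [Finset.mem_coe, Finset.mem_filter, hI, Finset.mem_Icc] at hm
      rw [Finset.mem_coe, Finset.mem_filter, Finset.mem_Icc]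
      refine ⟨⟨by dsimp only; omega, by dsimp only; omega⟩, ?_⟩
      have hle := round_le (((m - m₀ : ℤ) : ℝ) * u) (round (m * u) - round (m₀ * u))
      refine (mul_le_mul_of_nonneg_left hle hL0.le).trans ?_
      have e : (L : ℝ) * |((m - m₀ : ℤ) : ℝ) * u - ((round (m * u) - round (m₀ * u) : ℤ) : ℝ)| =
          |x m - x m₀| := by
        conv_lhs => rw [← abs_of_pos hL0, ← abs_mul]
        congr 1
        simp only [hx]
        push_cast
        ring
      rw [e]
      exact (Int.abs_sub_lt_one_of_floor_eq_floor (hm.2.trans hm₀.2.symm)).le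
    exact_mod_cast this
  calc ∑ m ∈ I, (1 + (x m) ^ 2)⁻¹ ≤ ∑ m ∈ I, 3 * (1 + (⌊x m⌋ : ℝ) ^ 2)⁻¹ :=
        Finset.sum_le_sum fun m _ => hterm m
    _ = ∑ j ∈ I.image (fun m => ⌊x m⌋), ∑ m ∈ I.filter (fun m => ⌊x m⌋ = j),
          3 * (1 + (⌊x m⌋ : ℝ) ^ 2)⁻¹ :=
        (Finset.sum_fiberwise_of_maps_to (fun m hm => Finset.mem_image_of_mem _ hm) _).symm
    _ ≤ ∑ j ∈ I.image (fun m => ⌊x m⌋), 561 / lam * (1 + (j : ℝ) ^ 2)⁻¹ := by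
        refine Finset.sum_le_sum fun j _ => ?_
        have e : ∑ m ∈ I.filter (fun m => ⌊x m⌋ = j), 3 * (1 + (⌊x m⌋ : ℝ) ^ 2)⁻¹ =
            ∑ m ∈ I.filter (fun m => ⌊x m⌋ = j), 3 * (1 + (j : ℝ) ^ 2)⁻¹ :=
          Finset.sum_congr rfl fun m hm => by rw [(Finset.mem_filter.mp hm).2]
        rw [e, Finset.sum_const, nsmul_eq_mul]
        have : 561 / lam * (1 + (j : ℝ) ^ 2)⁻¹ = 187 / lam * (3 * (1 + (j : ℝ) ^ 2)⁻¹) := by ring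
        rw [this]
        exact mul_le_mul_of_nonneg_right (hfiber j) (by positivity)
    _ ≤ 561 / lam * intInvSqSum := by
        rw [← Finset.mul_sum]
        exact mul_le_mul_of_nonneg_left
          (summable_int_inv_one_add_sq.sum_le_tsum _ fun _ _ => by positivity) (by positivity)
    _ = _ := by ring

/-- Weyl's inequality without logarithmic loss, uniform in the linear phase. -/
theorem exists_rational_norm_weylSum_sq_le {L : ℕ} (hL : 1 ≤ L) {t : ℝ} (ht0 : 0 ≤ t)
    (ht1 : t ≤ 1) :
    ∃ q ∈ Finset.Icc 1 L, ∃ a ∈ Finset.range (2 * q + 1), ∀ z : ℂ, ‖z‖ = 1 →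
      ‖weylSum L t z‖ ^ 2 * (q * max 1 ((L : ℝ) ^ 2 * |2 * t - a / q|)) ≤
        2805 * intInvSqSum * (L : ℝ) ^ 4 := by
  have hL' : (1 : ℝ) ≤ L := by exact_mod_cast hL
  have hL0 : (0 : ℝ) < L := by linarith
  obtain ⟨r, hr1, hr2⟩ := Real.exists_rat_abs_sub_le_and_den_le (2 * t) hL
  set q := r.den with hqdef
  have hq : 1 ≤ q := r.pos
  have hq0 : (0 : ℝ) < q := by exact_mod_cast hq
  have hr : (r : ℝ) = r.num / q := by exact_mod_cast (Rat.num_div_den r).symm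
  have hcop : IsCoprime r.num (q : ℤ) := by
    rw [Int.isCoprime_iff_gcd_eq_one, Int.gcd_eq_natAbs, Int.natAbs_natCast]
    exact r.reduced
  have habs : |q * (2 * t) - r.num| = q * |2 * t - r| := by
    rw [← abs_of_pos hq0, ← abs_mul, abs_of_pos hq0, hr]
    congr 1
    field_simp
  have hsmall : ((L : ℝ) + 1) * |q * (2 * t) - r.num| ≤ 1 := by
    rw [habs]
    rw [le_div_iff₀ (by positivity)] at hr1
    linarith
  have hsmall' : L * |q * (2 * t) - r.num| ≤ 1 := by
    nlinarith [abs_nonneg (q * (2 * t) - r.num)]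
  -- The denominator L + 1 in Dirichlet's theorem makes this strict; with 0 ≤ 2t ≤ 2 it forces 0 ≤ a
  -- ≤ 2q.
  have hlt1 : |q * (2 * t) - r.num| < 1 := by
    by_contra hcon
    push Not at hcon
    nlinarith
  rw [abs_lt] at hlt1
  have ha0 : 0 ≤ r.num := by
    have : (-1 : ℝ) < r.num := by nlinarith [mul_nonneg hq0.le ht0]
    have : (-1 : ℤ) < r.num := by exact_mod_cast this
    omega
  have ha1 : r.num < 2 * q + 1 := by
    have : (r.num : ℝ) < 2 * q + 1 := by nlinarith
    exact_mod_cast this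
  -- Chosen so that Lλ = q max(1, L²|2t - a/q|); whichever term attains the maximum supplies the
  -- alternative in the counting lemma.
  set lam := max ((q : ℝ) / L) (L * |q * (2 * t) - r.num|) with hlam
  have hlam0 : 0 < lam := lt_max_of_lt_left (by positivity)
  have hlam1 : lam ≤ 1 := max_le (by rw [div_le_one hL0]; exact_mod_cast hr2) hsmall'
  have c1 : (q : ℝ) ≤ lam * L := by
    rw [← div_le_iff₀ hL0]
    exact le_max_left _ _
  have c2 : L * |q * (2 * t) - r.num| ≤ lam := le_max_right _ _
  have c3 : lam * L ≤ q ∨ lam ≤ L * |q * (2 * t) - r.num| := by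
    rcases max_choice ((q : ℝ) / L) (L * |q * (2 * t) - r.num|) with h | h
    · left
      rw [hlam, h, div_mul_cancel₀ _ hL0.ne']
    · right
      exact hlam.le.trans h.le
  have hsum := sum_inv_one_add_sq_round_le hL hq hcop hlam1 hlam0 c1 c2 c3
  refine ⟨q, Finset.mem_Icc.mpr ⟨hq, hr2⟩, r.num.toNat, ?_, ?_⟩
  · rw [Finset.mem_range]
    omega
  intro z hz
  have hnum : ((r.num.toNat : ℕ) : ℝ) = r.num := by
    exact_mod_cast Int.toNat_of_nonneg ha0
  have e1 : (q : ℝ) * max 1 ((L : ℝ) ^ 2 * |2 * t - (r.num.toNat : ℕ) / q|) = L * lam := by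
    rw [hnum, ← hr, hlam, habs, mul_max_of_nonneg _ _ hq0.le, mul_max_of_nonneg _ _ hL0.le]
    congr 1
    · field_simp
    · ring
  rw [e1]
  have hW : ‖weylSum L t z‖ ^ 2 ≤ 5 * (L : ℝ) ^ 3 * (561 * intInvSqSum / lam) := by
    refine (norm_weylSum_sq_le L t hz).trans ?_
    refine le_trans ?_ (mul_le_mul_of_nonneg_left hsum (by positivity))
    rw [Finset.mul_sum]
    refine Finset.sum_le_sum fun m _ => ?_
    rw [← div_eq_mul_inv, le_div_iff₀ (by positivity)]
    exact norm_sum_tentCorr_mul_unitExp_le hL m _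
  calc ‖weylSum L t z‖ ^ 2 * (L * lam)
      ≤ 5 * (L : ℝ) ^ 3 * (561 * intInvSqSum / lam) * (L * lam) :=
        mul_le_mul_of_nonneg_right hW (by positivity)
    _ = _ := by
      field_simp
      ring

/-! ### Moments of the uniform norm of the Weyl sums -/

theorem integral_inv_one_add_sq_affine_le {c : ℝ} (hc : 0 < c) (x₀ : ℝ) :
    ∫ t in (0 : ℝ)..1, (1 + (c * (2 * t - x₀)) ^ 2)⁻¹ ≤ Real.pi / c := by
  have e : ∀ t : ℝ, (1 + (c * (2 * t - x₀)) ^ 2)⁻¹ =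
      (fun y : ℝ => (1 + y ^ 2)⁻¹) ((2 * c) * t - c * x₀) := fun t => by
    congr 3
    ring
  simp only [e]
  rw [intervalIntegral.integral_comp_mul_sub (fun y : ℝ => (1 + y ^ 2)⁻¹) (by positivity),
    integral_inv_one_add_sq, smul_eq_mul]
  have h1 := Real.arctan_lt_pi_div_two (2 * c * 1 - c * x₀)
  have h2 := Real.neg_pi_div_two_lt_arctan (2 * c * 0 - c * x₀)
  have h3 : Real.arctan (2 * c * 1 - c * x₀) - Real.arctan (2 * c * 0 - c * x₀) ≤ Real.pi := by
    linarith
  calc _ ≤ (2 * c)⁻¹ * Real.pi := mul_le_mul_of_nonneg_left h3 (by positivity)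
    _ ≤ _ := by
      rw [inv_mul_eq_div]
      exact div_le_div_of_nonneg_left Real.pi_pos.le hc (by linarith)

/-- Moment bound for the uniform norm of the quadratic Weyl sums: the norms of `S t` are dominated
by `V` times the `s`-th power of any uniform bound for `weylSum L t`. -/
theorem exists_integral_norm_le_of_weylSum_bound {s : ℝ} (hs : 4 < s) :
    ∃ C : ℝ, 0 < C ∧ ∀ (L : ℕ), 1 ≤ L → ∀ (V : ℝ), 0 ≤ V → ∀ S : ℝ → ℂ, Continuous S →
      (∀ t ∈ Set.Icc (0 : ℝ) 1, ∀ B : ℝ, 0 ≤ B →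
        (∀ z : ℂ, ‖z‖ = 1 → ‖weylSum L t z‖ ≤ B) → ‖S t‖ ≤ V * B ^ s) →
      ∫ t in (0 : ℝ)..1, ‖S t‖ ≤ C * V * (L : ℝ) ^ (2 * s - 2) := by
  set κ : ℝ := 2805 * intInvSqSum with hκ
  have hκ0 : 0 < κ := mul_pos (by norm_num) intInvSqSum_pos
  have hsum : Summable fun n : ℕ => (n : ℝ) ^ (1 - s / 2) :=
    Real.summable_nat_rpow.mpr (by linarith)
  set Z : ℝ := ∑' n : ℕ, (n : ℝ) ^ (1 - s / 2) with hZ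
  have hZ0 : 0 < Z := hsum.tsum_pos (fun _ => by positivity) 1 (by simp)
  refine ⟨6 * Real.pi * κ ^ (s / 2) * Z, by positivity, ?_⟩
  intro L hL V hV S hS hbound
  have hL0 : (0 : ℝ) < L := by exact_mod_cast hL
  -- Since s/2 ≥ 2, max(1, X)^(-s/2) is at most 2/(1 + X²), whose integral is an arctangent. Summing
  -- over all pairs (q, a) avoids choosing the approximation measurably in t.
  set F : ℕ → ℕ → ℝ → ℝ := fun q a t => V * (κ ^ (s / 2) * (L : ℝ) ^ (2 * s)) *
    (q : ℝ) ^ (-(s / 2)) * (2 * (1 + ((L : ℝ) ^ 2 * (2 * t - a / q)) ^ 2)⁻¹) with hF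
  have hF0 : ∀ q a t, 0 ≤ F q a t := fun q a t => by simp only [hF]; positivity
  have hFc : ∀ q a, Continuous (F q a) := fun q a => by
    simp only [hF]
    refine continuous_const.mul (continuous_const.mul (Continuous.inv₀ (by fun_prop) ?_))
    intro t
    positivity
  have hdom : ∀ t ∈ Set.Icc (0 : ℝ) 1, ‖S t‖ ≤
      ∑ q ∈ Finset.Icc 1 L, ∑ a ∈ Finset.range (2 * q + 1), F q a t := by
    intro t ht
    obtain ⟨q, hq, a, ha, hW⟩ := exists_rational_norm_weylSum_sq_le hL ht.1 ht.2
    have hq1 : 1 ≤ q := (Finset.mem_Icc.mp hq).1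
    have hq0 : (0 : ℝ) < q := by exact_mod_cast hq1
    set X : ℝ := (L : ℝ) ^ 2 * |2 * t - a / q| with hX
    have hM0 : 0 < max 1 X := lt_max_of_lt_left one_pos
    set Y : ℝ := κ * (L : ℝ) ^ 4 / (q * max 1 X) with hY
    have hY0 : 0 ≤ Y := by positivity
    have h1 := hbound t ht (Real.sqrt Y) (Real.sqrt_nonneg _) (fun z hz => by
      refine Real.le_sqrt_of_sq_le ?_
      rw [hY, le_div_iff₀ (by positivity)]
      exact hW z hz)
    have h2 : Real.sqrt Y ^ s ≤ (κ ^ (s / 2) * (L : ℝ) ^ (2 * s)) *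
        (q : ℝ) ^ (-(s / 2)) * (2 * (1 + ((L : ℝ) ^ 2 * (2 * t - a / q)) ^ 2)⁻¹) := by
      rw [Real.sqrt_eq_rpow, ← Real.rpow_mul hY0, one_div_mul_eq_div, hY,
        Real.div_rpow (by positivity) (by positivity), Real.mul_rpow hκ0.le (by positivity),
        Real.mul_rpow hq0.le hM0.le, ← Real.rpow_natCast (L : ℝ) 4, ← Real.rpow_mul hL0.le]
      have e : ((4 : ℕ) : ℝ) * (s / 2) = 2 * s := by push_cast; ring
      rw [e, div_eq_mul_inv, mul_inv, ← Real.rpow_neg hq0.le, ← mul_assoc]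
      refine mul_le_mul_of_nonneg_left ?_ (by positivity)
      have hX2 : ((L : ℝ) ^ 2 * (2 * t - a / q)) ^ 2 = X ^ 2 := by
        rw [hX, mul_pow, mul_pow, sq_abs]
      rw [hX2, ← div_eq_mul_inv, ← one_div, div_le_div_iff₀ (by positivity) (by positivity),
        one_mul]
      have h3 : (max 1 X) ^ (2 : ℝ) ≤ (max 1 X) ^ (s / 2) :=
        Real.rpow_le_rpow_of_exponent_le (le_max_left _ _) (by linarith)
      rw [Real.rpow_two] at h3
      have h4 : 1 ≤ (max 1 X) ^ 2 := one_le_pow₀ (le_max_left _ _)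
      have h5 : X ^ 2 ≤ (max 1 X) ^ 2 :=
        pow_le_pow_left₀ (by positivity) (le_max_right _ _) 2
      linarith
    have h3 : ‖S t‖ ≤ F q a t := by
      refine h1.trans ((mul_le_mul_of_nonneg_left h2 hV).trans (le_of_eq ?_))
      simp only [hF]
      ring
    refine h3.trans ?_
    refine le_trans ?_ (Finset.single_le_sum
      (f := fun q => ∑ a ∈ Finset.range (2 * q + 1), F q a t)
      (fun q _ => Finset.sum_nonneg fun a _ => hF0 q a t) hq)
    exact Finset.single_le_sum (f := fun a => F q a t) (fun a _ => hF0 q a t) ha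
  have hint : ∫ t in (0 : ℝ)..1, ‖S t‖ ≤ ∑ q ∈ Finset.Icc 1 L,
      ∑ a ∈ Finset.range (2 * q + 1), ∫ t in (0 : ℝ)..1, F q a t := by
    have e : ∑ q ∈ Finset.Icc 1 L, ∑ a ∈ Finset.range (2 * q + 1), ∫ t in (0 : ℝ)..1, F q a t =
        ∫ t in (0 : ℝ)..1, ∑ q ∈ Finset.Icc 1 L, ∑ a ∈ Finset.range (2 * q + 1), F q a t := by
      rw [intervalIntegral.integral_finsetSum]
      · refine Finset.sum_congr rfl fun q _ => ?_
        rw [intervalIntegral.integral_finsetSum]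
        exact fun a _ => (hFc q a).intervalIntegrable _ _
      · exact fun q _ => (continuous_finsetSum _ fun a _ => hFc q a).intervalIntegrable _ _
    rw [e]
    refine intervalIntegral.integral_mono_on zero_le_one (hS.norm.intervalIntegrable _ _) ?_ hdom
    exact (continuous_finsetSum _ fun q _ =>
      continuous_finsetSum _ fun a _ => hFc q a).intervalIntegrable _ _
  refine hint.trans ?_
  have hFint : ∀ q a, ∫ t in (0 : ℝ)..1, F q a t ≤
      2 * Real.pi * (V * κ ^ (s / 2) * (L : ℝ) ^ (2 * s - 2)) * (q : ℝ) ^ (-(s / 2)) := by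
    intro q a
    simp only [hF]
    rw [intervalIntegral.integral_const_mul, intervalIntegral.integral_const_mul]
    have h1 := integral_inv_one_add_sq_affine_le (c := (L : ℝ) ^ 2) (by positivity)
      ((a : ℝ) / q)
    have e : (L : ℝ) ^ (2 * s - 2) = (L : ℝ) ^ (2 * s) / (L : ℝ) ^ 2 := by
      rw [Real.rpow_sub hL0, Real.rpow_two]
    rw [e]
    refine (mul_le_mul_of_nonneg_left (mul_le_mul_of_nonneg_left h1 zero_le_two)
      (by positivity)).trans (le_of_eq ?_)
    ring
  calc _ ≤ ∑ q ∈ Finset.Icc 1 L, 6 * Real.pi * (V * κ ^ (s / 2) * (L : ℝ) ^ (2 * s - 2)) *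
        (q : ℝ) ^ (1 - s / 2) := by
        refine Finset.sum_le_sum fun q hq => ?_
        have hq1 : 1 ≤ q := (Finset.mem_Icc.mp hq).1
        have hq1' : (1 : ℝ) ≤ q := by exact_mod_cast hq1
        -- The 2q + 1 ≤ 3q numerators turn q^(-s/2) into q^(1-s/2).
        refine (Finset.sum_le_card_nsmul _ _ _ fun a _ => hFint q a).trans ?_
        rw [Finset.card_range, nsmul_eq_mul, sub_eq_add_neg 1 (s / 2),
          Real.rpow_add (by linarith), Real.rpow_one]
        push_cast
        have hnn : 0 ≤ 2 * Real.pi * (V * κ ^ (s / 2) * (L : ℝ) ^ (2 * s - 2)) *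
          (q : ℝ) ^ (-(s / 2)) := by positivity
        calc _ ≤ 3 * (q : ℝ) * (2 * Real.pi * (V * κ ^ (s / 2) * (L : ℝ) ^ (2 * s - 2)) *
              (q : ℝ) ^ (-(s / 2))) := mul_le_mul_of_nonneg_right (by linarith) hnn
          _ = _ := by ring
    _ ≤ 6 * Real.pi * (V * κ ^ (s / 2) * (L : ℝ) ^ (2 * s - 2)) * Z := by
        rw [← Finset.mul_sum]
        exact mul_le_mul_of_nonneg_left (hsum.sum_le_tsum _ fun _ _ => by positivity)
          (by positivity)
    _ = _ := by ring

/-! ### The circle method on spheres and annuli -/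

theorem integral_unitExp_mul_int (n : ℤ) :
    ∫ t in (0 : ℝ)..1, unitExp (t * n) = if n = 0 then 1 else 0 := by
  split_ifs with h
  · simp [h, unitExp_zero]
  have hc : (Complex.I * (2 * Real.pi * n) : ℂ) ≠ 0 := by
    have : (n : ℂ) ≠ 0 := by exact_mod_cast h
    simp [this, Real.pi_ne_zero]
  have e : ∀ t : ℝ, unitExp (t * n) = Complex.exp ((Complex.I * (2 * Real.pi * n)) * t) :=
    fun t => by
      rw [unitExp]
      congr 1
      push_cast
      ring
  simp only [e]
  rw [integral_exp_mul_complex hc]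
  have h1 : Complex.exp (Complex.I * (2 * Real.pi * n) * ((1 : ℝ) : ℂ)) = 1 := by
    rw [Complex.exp_eq_one_iff]
    exact ⟨n, by push_cast; ring⟩
  rw [h1]
  simp

/-- The cube `|k i| ≤ L` of integer vectors. -/
noncomputable def latticeBox (d L : ℕ) : Finset (Fin d → ℤ) :=
  Fintype.piFinset fun _ => Finset.Icc (-(L : ℤ)) L

/-- The product of tent weights. -/
def tentWeight {d : ℕ} (L : ℕ) (k : Fin d → ℤ) : ℤ := ∏ i, tent L (k i)

/-- The squared Euclidean length of an integer vector. -/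
def latticeSq {d : ℕ} (k : Fin d → ℤ) : ℤ := ∑ i, k i ^ 2

/-- The exponential sum `∑ w(k) b(k) e(t|k|²)` with tent weights `w`. -/
noncomputable def quadSum {d : ℕ} (L : ℕ) (b : (Fin d → ℤ) → ℝ) (t : ℝ) : ℂ :=
  ∑ k ∈ latticeBox d L, ((tentWeight L k : ℝ) * b k : ℝ) * unitExp (t * latticeSq k)

theorem tentWeight_nonneg {d : ℕ} (L : ℕ) (k : Fin d → ℤ) : 0 ≤ tentWeight L k :=
  Finset.prod_nonneg fun _ _ => tent_nonneg L _

theorem tentWeight_le {d : ℕ} (L : ℕ) (k : Fin d → ℤ) : tentWeight L k ≤ (L : ℤ) ^ d := by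
  refine (Finset.prod_le_prod (fun i _ => tent_nonneg L _) fun i _ => tent_le L (k i)).trans ?_
  simp

theorem continuous_quadSum {d : ℕ} (L : ℕ) (b : (Fin d → ℤ) → ℝ) : Continuous (quadSum L b) := by
  unfold quadSum
  exact continuous_finsetSum _ fun k _ =>
    continuous_const.mul (continuous_unitExp.comp (by fun_prop))

theorem sum_level_eq_integral {d : ℕ} (L : ℕ) (b : (Fin d → ℤ) → ℝ) (n : ℤ) :
    ((∑ k ∈ (latticeBox d L).filter (fun k => latticeSq k = n), (tentWeight L k : ℝ) * b k : ℝ) : ℂ)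
      = ∫ t in (0 : ℝ)..1, quadSum L b t * unitExp (-(t * n)) := by
  have e : ∀ t : ℝ, quadSum L b t * unitExp (-(t * n)) = ∑ k ∈ latticeBox d L,
      ((tentWeight L k : ℝ) * b k : ℝ) * unitExp (t * ((latticeSq k - n : ℤ) : ℝ)) := by
    intro t
    rw [quadSum, Finset.sum_mul]
    refine Finset.sum_congr rfl fun k _ => ?_
    rw [mul_assoc, ← unitExp_add]
    congr 2
    push_cast
    ring
  simp only [e]
  rw [intervalIntegral.integral_finsetSum]
  · simp only [intervalIntegral.integral_const_mul, integral_unitExp_mul_int, sub_eq_zero]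
    rw [Finset.sum_filter]
    push_cast
    refine Finset.sum_congr rfl fun k _ => ?_
    split_ifs <;> simp
  · intro k _
    exact (continuous_const.mul (continuous_unitExp.comp (by fun_prop))).intervalIntegrable _ _

/-- A Fourier coefficient is at most the L¹ norm. The bound does not depend on n, so a set of levels
costs only its cardinality. -/
theorem sum_level_le_integral {d : ℕ} (L : ℕ) (b : (Fin d → ℤ) → ℝ) (n : ℤ) :
    ∑ k ∈ (latticeBox d L).filter (fun k => latticeSq k = n), (tentWeight L k : ℝ) * b k ≤
      ∫ t in (0 : ℝ)..1, ‖quadSum L b t‖ := by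
  have h := congrArg norm (sum_level_eq_integral L b n)
  rw [Complex.norm_real] at h
  refine (Real.le_norm_self _).trans (h.le.trans ?_)
  refine (intervalIntegral.norm_integral_le_integral_norm zero_le_one).trans (le_of_eq ?_)
  simp only [norm_mul, norm_unitExp, mul_one]

theorem sum_levels_le_integral {d : ℕ} (L : ℕ) (b : (Fin d → ℤ) → ℝ) (W : Finset ℤ) :
    ∑ k ∈ (latticeBox d L).filter (fun k => latticeSq k ∈ W), (tentWeight L k : ℝ) * b k ≤
      W.card * ∫ t in (0 : ℝ)..1, ‖quadSum L b t‖ := by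
  have e : ∑ k ∈ (latticeBox d L).filter (fun k => latticeSq k ∈ W), (tentWeight L k : ℝ) * b k =
      ∑ n ∈ W, ∑ k ∈ (latticeBox d L).filter (fun k => latticeSq k = n),
        (tentWeight L k : ℝ) * b k := by
    rw [← Finset.sum_fiberwise_of_maps_to (t := W) (g := latticeSq)
      (fun k hk => (Finset.mem_filter.mp hk).2)]
    refine Finset.sum_congr rfl fun n hn => Finset.sum_congr ?_ fun _ _ => rfl
    ext k
    simp only [Finset.mem_filter]
    constructor
    · exact fun h => ⟨h.1.1, h.2⟩
    · exact fun h => ⟨⟨h.1, h.2 ▸ hn⟩, h.2⟩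
  rw [e, ← nsmul_eq_mul]
  exact Finset.sum_le_card_nsmul _ _ _ fun n _ => sum_level_le_integral L b n

theorem latticeNorm_sq {d : ℕ} (k : Fin d → ℤ) : latticeNorm k ^ 2 = latticeSq k := by
  rw [latticeNorm, Real.sq_sqrt (Finset.sum_nonneg fun i _ => sq_nonneg _), latticeSq]
  push_cast
  rfl

theorem latticeNorm_nonneg {d : ℕ} (k : Fin d → ℤ) : 0 ≤ latticeNorm k := Real.sqrt_nonneg _

theorem abs_coord_le_latticeNorm {d : ℕ} (k : Fin d → ℤ) (i : Fin d) :
    |(k i : ℝ)| ≤ latticeNorm k := by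
  rw [← Real.sqrt_sq_eq_abs]
  exact Real.sqrt_le_sqrt (Finset.single_le_sum (f := fun j => (k j : ℝ) ^ 2)
    (fun j _ => sq_nonneg _) (Finset.mem_univ i))

/-- Sums over the annulus are controlled by the exponential sums `quadSum`. -/
theorem exists_sum_annulus_le (d : ℕ) {A : ℝ} (hA : 1 ≤ A) {s : ℝ} (hs : 4 < s) :
    ∃ C : ℝ, 0 < C ∧ ∀ N R δ : ℝ, 1 ≤ N → N / A ≤ R → R ≤ A * N → 1 / (A * N) ≤ δ → δ ≤ 1 →
      ∀ (V : ℝ), 0 ≤ V → ∀ b : (Fin d → ℤ) → ℝ, (∀ k, 0 ≤ b k) →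
      (∀ t ∈ Set.Icc (0 : ℝ) 1, ∀ B : ℝ, 0 ≤ B →
        (∀ z : ℂ, ‖z‖ = 1 → ‖weylSum ⌈4 * A * N⌉₊ t z‖ ≤ B) →
        ‖quadSum ⌈4 * A * N⌉₊ b t‖ ≤ V * (⌈4 * A * N⌉₊ : ℝ) ^ (d - s) * B ^ s) →
      ∑ k ∈ (annulus_finite d R δ).toFinset, b k ≤ C * V * (N ^ (s - 1) * δ) := by
  obtain ⟨C₁, hC₁, hmoment⟩ := exists_integral_norm_le_of_weylSum_bound hs
  refine ⟨2 ^ d * (5 * A) * C₁ * (5 * A) ^ (s - 2), by positivity, ?_⟩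
  intro N R δ hN hR1 hR2 hδ1 hδ2 V hV b hb hbound
  have hAN : 1 ≤ A * N := one_le_mul_of_one_le_of_one_le hA hN
  have hN0 : 0 < N := by linarith
  have hR0 : 0 < R := lt_of_lt_of_le (by positivity) hR1
  have hANδ : 1 ≤ A * N * δ := by
    rw [div_le_iff₀ (by positivity)] at hδ1
    linarith
  have hδ0 : 0 < δ := lt_of_lt_of_le (by positivity) hδ1
  -- On the annulus |k| ≤ 2AN ≤ L/2, so every tent factor is at least L/2 there.
  set L := ⌈4 * A * N⌉₊ with hLdef
  have hL4 : 4 * A * N ≤ L := Nat.le_ceil _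
  have hL5 : (L : ℝ) ≤ 5 * A * N := by
    have := (Nat.ceil_lt_add_one (by positivity : 0 ≤ 4 * A * N)).le
    rw [← hLdef] at this
    linarith
  have hL0 : (0 : ℝ) < L := by linarith
  have hL1 : 1 ≤ L := by exact_mod_cast hL0
  have hI := hmoment L hL1 (V * (L : ℝ) ^ (d - s)) (by positivity) (quadSum L b)
    (continuous_quadSum L b) hbound
  -- The radius comes from ||k|² - R²| = (|k| + R)||k| - R| ≤ 4AN · δ/2. The count is at most 4ANδ +
  -- 1, and the 1 is absorbed because ANδ ≥ 1.
  set W : Finset ℤ := Finset.Icc ⌈R ^ 2 - 2 * (A * N * δ)⌉ ⌊R ^ 2 + 2 * (A * N * δ)⌋ with hW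
  have hWcard : (W.card : ℝ) ≤ 5 * (A * N * δ) := by
    rw [hW, Int.card_Icc]
    have h1 : (⌊R ^ 2 + 2 * (A * N * δ)⌋ : ℝ) ≤ R ^ 2 + 2 * (A * N * δ) := Int.floor_le _
    have h2 : R ^ 2 - 2 * (A * N * δ) ≤ (⌈R ^ 2 - 2 * (A * N * δ)⌉ : ℝ) := Int.le_ceil _
    rw [← Int.cast_natCast (R := ℝ), Int.ofNat_toNat, Int.cast_max]
    refine max_le ?_ (by push_cast; positivity)
    push_cast
    linarith
  have hann : ∀ k ∈ (annulus_finite d R δ).toFinset,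
      k ∈ (latticeBox d L).filter (fun k => latticeSq k ∈ W) ∧
        ((L : ℝ) / 2) ^ d ≤ tentWeight L k := by
    intro k hk
    rw [Set.Finite.mem_toFinset] at hk
    have hk' : |latticeNorm k - R| ≤ δ / 2 := hk
    have hkabs := abs_le.mp hk'
    have hn0 := latticeNorm_nonneg k
    have hkn : latticeNorm k ≤ 2 * (A * N) := by linarith
    have hki : ∀ i, |(k i : ℝ)| ≤ L / 2 := fun i =>
      (abs_coord_le_latticeNorm k i).trans (by linarith)
    refine ⟨?_, ?_⟩
    · rw [Finset.mem_filter, latticeBox, Fintype.mem_piFinset]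
      refine ⟨fun i => ?_, ?_⟩
      · have h := abs_le.mp (hki i)
        rw [Finset.mem_Icc]
        have h1 : (-(L : ℝ)) ≤ k i := by linarith
        have h2 : (k i : ℝ) ≤ L := by linarith
        exact ⟨by exact_mod_cast h1, by exact_mod_cast h2⟩
      · have h1 : |(latticeSq k : ℝ) - R ^ 2| ≤ 2 * (A * N * δ) := by
          rw [← latticeNorm_sq, sq_sub_sq, abs_mul, abs_of_nonneg (by positivity)]
          calc (latticeNorm k + R) * |latticeNorm k - R|
              ≤ (4 * (A * N)) * (δ / 2) :=
                mul_le_mul (by linarith) hk' (abs_nonneg _) (by positivity)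
            _ = _ := by ring
        have h2 := abs_le.mp h1
        rw [hW, Finset.mem_Icc]
        exact ⟨Int.ceil_le.mpr (by linarith), Int.le_floor.mpr (by linarith)⟩
    · rw [tentWeight]
      push_cast
      have : ((L : ℝ) / 2) ^ d = ∏ _i : Fin d, (L : ℝ) / 2 := by
        rw [Finset.prod_const, Finset.card_univ, Fintype.card_fin]
      rw [this]
      refine Finset.prod_le_prod (fun i _ => by positivity) fun i _ => ?_
      have h := abs_le.mp (hki i)
      rw [tent]
      push_cast
      refine le_max_of_le_right (le_min (by linarith) (by linarith))
  have hmain : ((L : ℝ) / 2) ^ d * ∑ k ∈ (annulus_finite d R δ).toFinset, b k ≤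
      5 * (A * N * δ) * (C₁ * (V * (L : ℝ) ^ (d - s)) * (L : ℝ) ^ (2 * s - 2)) := by
    rw [Finset.mul_sum]
    calc _ ≤ ∑ k ∈ (annulus_finite d R δ).toFinset, (tentWeight L k : ℝ) * b k :=
          Finset.sum_le_sum fun k hk => mul_le_mul_of_nonneg_right (hann k hk).2 (hb k)
      _ ≤ ∑ k ∈ (latticeBox d L).filter (fun k => latticeSq k ∈ W),
            (tentWeight L k : ℝ) * b k := by
          refine Finset.sum_le_sum_of_subset_of_nonneg (fun k hk => (hann k hk).1) ?_
          intro k _ _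
          exact mul_nonneg (by exact_mod_cast tentWeight_nonneg L k) (hb k)
      _ ≤ W.card * ∫ t in (0 : ℝ)..1, ‖quadSum L b t‖ := sum_levels_le_integral L b W
      _ ≤ _ := mul_le_mul hWcard hI
          (intervalIntegral.integral_nonneg zero_le_one fun _ _ => norm_nonneg _) (by positivity)
  -- The factor L^d cancels the size of the tent weights; L^(s-2) and the Nδ levels give N^(s-1)δ.
  have hpow : (L : ℝ) ^ (d - s) * (L : ℝ) ^ (2 * s - 2) = (L : ℝ) ^ d * (L : ℝ) ^ (s - 2) := by
    rw [← Real.rpow_natCast (L : ℝ) d, ← Real.rpow_add hL0, ← Real.rpow_add hL0]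
    congr 1
    ring
  have hLs : (L : ℝ) ^ (s - 2) ≤ (5 * A) ^ (s - 2) * N ^ (s - 2) := by
    rw [← Real.mul_rpow (by positivity) hN0.le]
    exact Real.rpow_le_rpow hL0.le hL5 (by linarith)
  have hNs : N ^ (s - 1) = N ^ (s - 2) * N := by
    rw [← Real.rpow_add_one hN0.ne']
    congr 1
    ring
  have hLd : 0 < ((L : ℝ) / 2) ^ d := by positivity
  refine le_of_mul_le_mul_left (hmain.trans ?_) hLd
  calc _ = 5 * (A * N * δ) * C₁ * V * ((L : ℝ) ^ (d - s) * (L : ℝ) ^ (2 * s - 2)) := by ring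
    _ = (5 * (A * N * δ) * C₁ * V * (L : ℝ) ^ d) * (L : ℝ) ^ (s - 2) := by rw [hpow]; ring
    _ ≤ (5 * (A * N * δ) * C₁ * V * (L : ℝ) ^ d) * ((5 * A) ^ (s - 2) * N ^ (s - 2)) :=
        mul_le_mul_of_nonneg_left hLs (by positivity)
    _ = _ := by
      rw [hNs, div_pow]
      field_simp

/-! ### The product kernel and Fourier coefficients on the torus -/

theorem unitExp_sum {ι : Type*} (u : Finset ι) (f : ι → ℝ) :
    unitExp (∑ i ∈ u, f i) = ∏ i ∈ u, unitExp (f i) := by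
  classical
  induction u using Finset.induction_on with
  | empty => simp [unitExp_zero]
  | insert a u ha ih => rw [Finset.sum_insert ha, Finset.prod_insert ha, unitExp_add, ih]

/-- The `d`-dimensional kernel factors into one-dimensional Weyl sums. -/
theorem sum_latticeBox_eq_prod_weylSum {d : ℕ} (L : ℕ) (t : ℝ) (z : Fin d → ℂ) :
    ∑ k ∈ latticeBox d L, (tentWeight L k : ℂ) * unitExp (t * latticeSq k) * ∏ i, z i ^ k i =
      ∏ i, weylSum L t (z i) := by
  simp only [weylSum]
  rw [Finset.prod_univ_sum, latticeBox]
  refine Finset.sum_congr rfl fun k _ => ?_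
  rw [Finset.prod_mul_distrib, Finset.prod_mul_distrib, ← unitExp_sum, tentWeight, latticeSq]
  push_cast
  rw [Finset.mul_sum]

theorem norm_sum_latticeBox_le {d : ℕ} {L : ℕ} {t B : ℝ}
    (hB : ∀ z : ℂ, ‖z‖ = 1 → ‖weylSum L t z‖ ≤ B) {z : Fin d → ℂ} (hz : ∀ i, ‖z i‖ = 1) :
    ‖∑ k ∈ latticeBox d L, (tentWeight L k : ℂ) * unitExp (t * latticeSq k) * ∏ i, z i ^ k i‖ ≤
      B ^ d := by
  rw [sum_latticeBox_eq_prod_weylSum, norm_prod]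
  refine (Finset.prod_le_prod (fun i _ => norm_nonneg _) fun i _ => hB _ (hz i)).trans ?_
  simp

theorem volume_unitAddTorus_eq_pi_haar (d : ℕ) :
    (volume : Measure (UnitAddTorus (Fin d))) =
      Measure.pi fun _ => (AddCircle.haarAddCircle : Measure UnitAddCircle) := by
  have h : (volume : Measure UnitAddCircle) = AddCircle.haarAddCircle := by
    rw [AddCircle.volume_eq_smul_haarAddCircle]
    simp
  change Measure.pi (fun _ => (volume : Measure UnitAddCircle)) = _
  simp only [h]

theorem isProbabilityMeasure_volume_unitAddTorus (d : ℕ) :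
    IsProbabilityMeasure (volume : Measure (UnitAddTorus (Fin d))) := by
  rw [volume_unitAddTorus_eq_pi_haar]
  infer_instance

theorem mFourierCoeff_eq_integral_volume {d : ℕ} (g : UnitAddTorus (Fin d) → ℂ)
    (k : Fin d → ℤ) :
    UnitAddTorus.mFourierCoeff g k = ∫ x, UnitAddTorus.mFourier (-k) x * g x := by
  rw [volume_unitAddTorus_eq_pi_haar]
  rfl

/-- Bessel's inequality on the torus. -/
theorem sum_sq_norm_mFourierCoeff_le {d : ℕ} {g : UnitAddTorus (Fin d) → ℂ}
    (hg : MemLp g 2 volume) (u : Finset (Fin d → ℤ)) :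
    ∑ k ∈ u, ‖UnitAddTorus.mFourierCoeff g k‖ ^ 2 ≤ ∫ x, ‖g x‖ ^ 2 := by
  rw [volume_unitAddTorus_eq_pi_haar] at hg ⊢
  have hs := UnitAddTorus.hasSum_sq_mFourierCoeff (d := Fin d) (hg.toLp g)
  have hae := hg.coeFn_toLp
  have h1 : ∀ k, UnitAddTorus.mFourierCoeff (hg.toLp g) k = UnitAddTorus.mFourierCoeff g k :=
    fun k => integral_congr_ae (by
      filter_upwards [hae] with x hx
      rw [hx])
  have h2 := sum_le_hasSum u (fun k _ => sq_nonneg _) hs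
  simp only [h1] at h2
  refine h2.trans (le_of_eq (integral_congr_ae ?_))
  filter_upwards [hae] with x hx
  rw [hx]

theorem fourier_eq_zpow (n : ℤ) (x : UnitAddCircle) :
    (fourier n x : ℂ) = (fourier 1 x : ℂ) ^ n := by
  rw [fourier_apply, fourier_apply, AddCircle.toCircle_zsmul, one_zsmul]
  push_cast
  rfl

theorem norm_fourier_apply (n : ℤ) (x : UnitAddCircle) : ‖(fourier n x : ℂ)‖ = 1 := by
  rw [fourier_apply]
  exact Circle.norm_coe _

theorem norm_mFourier_apply {d : ℕ} (k : Fin d → ℤ) (x : UnitAddTorus (Fin d)) :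
    ‖UnitAddTorus.mFourier k x‖ = 1 := by
  simp only [UnitAddTorus.mFourier, ContinuousMap.coe_mk, norm_prod, norm_fourier_apply,
    Finset.prod_const_one]

theorem integrable_mFourier_mul {d : ℕ} {g : UnitAddTorus (Fin d) → ℂ} (hg : Integrable g)
    (k : Fin d → ℤ) : Integrable fun x => UnitAddTorus.mFourier k x * g x :=
  hg.bdd_mul (c := 1) (UnitAddTorus.mFourier k).continuous.aestronglyMeasurable
    (Filter.Eventually.of_forall fun x => (norm_mFourier_apply k x).le)

theorem conj_mFourierCoeff {d : ℕ} (g : UnitAddTorus (Fin d) → ℂ) (k : Fin d → ℤ) :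
    (starRingEnd ℂ) (UnitAddTorus.mFourierCoeff g k) =
      ∫ y, UnitAddTorus.mFourier k y * (starRingEnd ℂ) (g y) := by
  rw [mFourierCoeff_eq_integral_volume, ← integral_conj]
  refine integral_congr_ae (Filter.Eventually.of_forall fun y => ?_)
  simp only [map_mul, UnitAddTorus.mFourier_neg, Complex.conj_conj]

theorem integrable_conj {d : ℕ} {g : UnitAddTorus (Fin d) → ℂ} (hg : Integrable g) :
    Integrable fun x => (starRingEnd ℂ) (g x) :=
  hg.norm.mono' (Complex.continuous_conj.comp_aestronglyMeasurable hg.aestronglyMeasurable)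
    (Filter.Eventually.of_forall fun x => by simp)

/-- The dispersive (L¹ to L^∞) bound: the sum is a quadratic form in g whose convolution kernel is a
product of d Weyl sums at the phases e(yᵢ - xᵢ). -/
theorem norm_quadSum_sq_mFourierCoeff_le_pow {d : ℕ} {L : ℕ} {t B : ℝ}
    (hB : ∀ z : ℂ, ‖z‖ = 1 → ‖weylSum L t z‖ ≤ B) {g : UnitAddTorus (Fin d) → ℂ}
    (hg : Integrable g) :
    ‖quadSum L (fun k => ‖UnitAddTorus.mFourierCoeff g k‖ ^ 2) t‖ ≤ B ^ d * (∫ x, ‖g x‖) ^ 2 := by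
  set c : (Fin d → ℤ) → ℂ := fun k => (tentWeight L k : ℂ) * unitExp (t * latticeSq k) with hc
  have hker : ∀ x y : UnitAddTorus (Fin d), ‖∑ k ∈ latticeBox d L,
      c k * (UnitAddTorus.mFourier k y * UnitAddTorus.mFourier (-k) x)‖ ≤ B ^ d := by
    intro x y
    have h := norm_sum_latticeBox_le (d := d) hB
      (z := fun i => (fourier 1 (y i) : ℂ) * (starRingEnd ℂ) (fourier 1 (x i) : ℂ))
      (fun i => by rw [norm_mul, RCLike.norm_conj, norm_fourier_apply, norm_fourier_apply, mul_one])
    refine le_trans (le_of_eq ?_) h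
    congr 1
    refine Finset.sum_congr rfl fun k _ => ?_
    rw [UnitAddTorus.mFourier_neg]
    simp only [hc, UnitAddTorus.mFourier, ContinuousMap.coe_mk, map_prod,
      ← Finset.prod_mul_distrib]
    congr 1
    refine Finset.prod_congr rfl fun i _ => ?_
    rw [fourier_eq_zpow (k i) (x i), fourier_eq_zpow (k i) (y i), mul_zpow, map_zpow₀]
  have hinner : ∀ y, ‖∑ k ∈ latticeBox d L,
      c k * UnitAddTorus.mFourierCoeff g k * UnitAddTorus.mFourier k y‖ ≤
        B ^ d * ∫ x, ‖g x‖ := by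
    intro y
    have e : ∑ k ∈ latticeBox d L,
        c k * UnitAddTorus.mFourierCoeff g k * UnitAddTorus.mFourier k y =
        ∫ x, (∑ k ∈ latticeBox d L,
          c k * (UnitAddTorus.mFourier k y * UnitAddTorus.mFourier (-k) x)) * g x := by
      simp only [Finset.sum_mul]
      have e' : ∀ (k : Fin d → ℤ) (x : UnitAddTorus (Fin d)),
          c k * (UnitAddTorus.mFourier k y * UnitAddTorus.mFourier (-k) x) * g x =
          (c k * UnitAddTorus.mFourier k y) * (UnitAddTorus.mFourier (-k) x * g x) :=
        fun k x => by ring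
      simp only [e']
      rw [integral_finsetSum _ fun k _ => (integrable_mFourier_mul hg (-k)).const_mul _]
      refine Finset.sum_congr rfl fun k _ => ?_
      rw [integral_const_mul, ← mFourierCoeff_eq_integral_volume]
      ring
    rw [e, ← integral_const_mul]
    refine norm_integral_le_of_norm_le (hg.norm.const_mul _)
      (Filter.Eventually.of_forall fun x => ?_)
    rw [norm_mul]
    exact mul_le_mul_of_nonneg_right (hker x y) (norm_nonneg _)
  have e : quadSum L (fun k => ‖UnitAddTorus.mFourierCoeff g k‖ ^ 2) t =
      ∫ y, (∑ k ∈ latticeBox d L,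
        c k * UnitAddTorus.mFourierCoeff g k * UnitAddTorus.mFourier k y) *
          (starRingEnd ℂ) (g y) := by
    simp only [Finset.sum_mul, mul_assoc _ (UnitAddTorus.mFourier _ _)]
    rw [integral_finsetSum _ fun k _ =>
      (integrable_mFourier_mul (integrable_conj hg) k).const_mul _, quadSum]
    refine Finset.sum_congr rfl fun k _ => ?_
    rw [integral_const_mul, ← conj_mFourierCoeff, mul_assoc, Complex.mul_conj']
    simp only [hc]
    push_cast
    ring
  rw [e]
  have e2 : B ^ d * (∫ x, ‖g x‖) ^ 2 = ∫ y, (B ^ d * ∫ x, ‖g x‖) * ‖g y‖ := by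
    rw [integral_const_mul]
    ring
  rw [e2]
  refine norm_integral_le_of_norm_le (hg.norm.const_mul _)
    (Filter.Eventually.of_forall fun y => ?_)
  rw [norm_mul, RCLike.norm_conj]
  exact mul_le_mul_of_nonneg_right (hinner y) (norm_nonneg _)

/-- The L² endpoint: the multiplier has size at most L^d, and Bessel's inequality does the rest. -/
theorem norm_quadSum_sq_mFourierCoeff_le {d : ℕ} (L : ℕ) (t : ℝ) {g : UnitAddTorus (Fin d) → ℂ}
    (hg : MemLp g 2 volume) :
    ‖quadSum L (fun k => ‖UnitAddTorus.mFourierCoeff g k‖ ^ 2) t‖ ≤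
      (L : ℝ) ^ d * ∫ x, ‖g x‖ ^ 2 := by
  rw [quadSum]
  refine (norm_sum_le _ _).trans (le_trans ?_ (mul_le_mul_of_nonneg_left
    (sum_sq_norm_mFourierCoeff_le hg (latticeBox d L)) (by positivity)))
  rw [Finset.mul_sum]
  refine Finset.sum_le_sum fun k _ => ?_
  have h1 : (0 : ℝ) ≤ tentWeight L k := by exact_mod_cast tentWeight_nonneg L k
  have h2 : (tentWeight L k : ℝ) ≤ (L : ℝ) ^ d := by exact_mod_cast tentWeight_le L k
  rw [norm_mul, norm_unitExp, mul_one, Complex.norm_real,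
    Real.norm_of_nonneg (by positivity)]
  exact mul_le_mul_of_nonneg_right h2 (by positivity)

/-! ### Restricted estimate and lattice point count on the annulus -/

/-- Restricted estimate for the Fourier coefficients, on the annulus, of a function bounded by the
indicator of a set `E`. -/
theorem exists_sum_annulus_sq_mFourierCoeff_le (d : ℕ) {A : ℝ} (hA : 1 ≤ A) {θ : ℝ}
    (hθ : 4 < d * θ) (hθ0 : 0 < θ) (hθ1 : θ ≤ 1) :
    ∃ C : ℝ, 0 < C ∧ ∀ N R δ : ℝ, 1 ≤ N → N / A ≤ R → R ≤ A * N → 1 / (A * N) ≤ δ → δ ≤ 1 →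
      ∀ (E : Set (UnitAddTorus (Fin d))), MeasurableSet E → ∀ g : UnitAddTorus (Fin d) → ℂ,
      AEStronglyMeasurable g volume → (∀ x, ‖g x‖ ≤ E.indicator 1 x) →
      ∑ k ∈ (annulus_finite d R δ).toFinset, ‖UnitAddTorus.mFourierCoeff g k‖ ^ 2 ≤
        C * volume.real E ^ (1 + θ) * (N ^ (d * θ - 1) * δ) := by
  have := isProbabilityMeasure_volume_unitAddTorus d
  obtain ⟨C, hC, h⟩ := exists_sum_annulus_le d hA hθ
  refine ⟨C, hC, ?_⟩
  intro N R δ hN hR1 hR2 hδ1 hδ2 E hE g hgm hgE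
  set ε := volume.real E with hε
  have hε0 : 0 ≤ ε := measureReal_nonneg
  have hg1 : ∀ x, ‖g x‖ ≤ 1 := fun x =>
    (hgE x).trans (Set.indicator_le' (fun _ _ => le_rfl) (fun _ _ => zero_le_one) x)
  have hgi : MemLp g ∞ volume := memLp_top_of_bound hgm 1 (Filter.Eventually.of_forall hg1)
  have hg2 : MemLp g 2 volume := hgi.mono_exponent le_top
  have hgint : Integrable g := hgi.integrable le_top
  have hI1 : ∫ x, ‖g x‖ ≤ ε := by
    rw [hε, ← integral_indicator_one hE]
    exact integral_mono hgint.norm ((integrable_indicator_iff hE).mpr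
      (integrable_const (1 : ℝ)).integrableOn) hgE
  have hI2 : ∫ x, ‖g x‖ ^ 2 ≤ ε := by
    refine le_trans (integral_mono ?_ hgint.norm fun x => ?_) hI1
    · exact (memLp_two_iff_integrable_sq_norm hgm).mp hg2
    · have := hg1 x
      have := norm_nonneg (g x)
      simp only
      nlinarith
  refine h N R δ hN hR1 hR2 hδ1 hδ2 (ε ^ (1 + θ)) (by positivity) _ (fun k => sq_nonneg _) ?_
  intro t _ B hB hW
  set L := ⌈4 * A * N⌉₊
  have hb1 := norm_quadSum_sq_mFourierCoeff_le_pow hW hgint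
  have hb2 := norm_quadSum_sq_mFourierCoeff_le L t hg2
  set Q := ‖quadSum L (fun k => ‖UnitAddTorus.mFourierCoeff g k‖ ^ 2) t‖ with hQ
  have hQ0 : 0 ≤ Q := norm_nonneg _
  have hb1' : Q ≤ B ^ d * ε ^ 2 := hb1.trans (mul_le_mul_of_nonneg_left
    (pow_le_pow_left₀ (integral_nonneg fun _ => norm_nonneg _) hI1 2) (by positivity))
  have hb2' : Q ≤ (L : ℝ) ^ d * ε := hb2.trans (mul_le_mul_of_nonneg_left hI2 (by positivity))
  -- Interpolating the two bounds gives ε^(2θ + 1 - θ) = ε^(1+θ) and L^(d(1-θ)) B^(dθ), the form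
  -- required with s = dθ.
  have e1 : Q = Q ^ θ * Q ^ (1 - θ) := by
    rw [← Real.rpow_add_of_nonneg hQ0 hθ0.le (by linarith)]
    simp
  rw [e1]
  calc Q ^ θ * Q ^ (1 - θ) ≤ (B ^ d * ε ^ 2) ^ θ * ((L : ℝ) ^ d * ε) ^ (1 - θ) :=
        mul_le_mul (Real.rpow_le_rpow hQ0 hb1' hθ0.le)
          (Real.rpow_le_rpow hQ0 hb2' (by linarith)) (by positivity) (by positivity)
    _ = _ := by
      rw [Real.mul_rpow (by positivity) (by positivity), Real.mul_rpow (by positivity) hε0,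
        ← Real.rpow_natCast B d, ← Real.rpow_natCast (L : ℝ) d, ← Real.rpow_natCast ε 2,
        ← Real.rpow_mul hB, ← Real.rpow_mul hε0, ← Real.rpow_mul (Nat.cast_nonneg L)]
      have e2 : ε ^ (1 + θ) = ε ^ (((2 : ℕ) : ℝ) * θ) * ε ^ (1 - θ) := by
        rw [← Real.rpow_add_of_nonneg hε0 (by positivity) (by linarith)]
        congr 1
        push_cast
        ring
      have e3 : (d : ℝ) - d * θ = d * (1 - θ) := by ring
      rw [e2, e3]
      ring

/-- Constant coefficients b = 1 with s = d: `quadSum` is then the product kernel at the origin. The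
condition s > 4 becomes d ≥ 5. -/
theorem exists_card_annulus_le {d : ℕ} (hd : 5 ≤ d) {A : ℝ} (hA : 1 ≤ A) :
    ∃ C : ℝ, 0 < C ∧ ∀ N R δ : ℝ, 1 ≤ N → N / A ≤ R → R ≤ A * N → 1 / (A * N) ≤ δ → δ ≤ 1 →
      ((annulus_finite d R δ).toFinset.card : ℝ) ≤ C * (N ^ ((d : ℝ) - 1) * δ) := by
  have hd' : (4 : ℝ) < d := by
    have : (5 : ℝ) ≤ d := by exact_mod_cast hd
    linarith
  obtain ⟨C, hC, h⟩ := exists_sum_annulus_le d hA hd'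
  refine ⟨C, hC, ?_⟩
  intro N R δ hN hR1 hR2 hδ1 hδ2
  have := h N R δ hN hR1 hR2 hδ1 hδ2 1 zero_le_one (fun _ => 1) (fun _ => zero_le_one) ?_
  · simpa using this
  intro t _ B hB hW
  rw [sub_self, Real.rpow_zero, one_mul, one_mul, Real.rpow_natCast]
  have h1 := norm_sum_latticeBox_le (d := d) hW (z := fun _ => 1) (fun _ => by simp)
  simpa [quadSum] using h1

/-! ### Level sets, weak-type bounds and duality -/

/-- A bounded function satisfying a weak-type bound with exponent `r < P` is in `L^P`. -/
theorem lintegral_rpow_le_of_weak_bound {X : Type*} [MeasurableSpace X] {μ : Measure X}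
    {h : X → ℝ} (hm : Measurable h) (h0 : ∀ x, 0 ≤ h x) {B K r P : ℝ} (hB : 0 ≤ B)
    (hhB : ∀ x, h x ≤ B) (hK : 0 ≤ K) (hr : 0 < r) (hrP : r < P)
    (hweak : ∀ α : ℝ, 0 < α → μ {x | α < h x} ≤ ENNReal.ofReal (K * α ^ (-r))) :
    ∫⁻ x, ENNReal.ofReal (h x ^ P) ∂μ ≤ ENNReal.ofReal (P / (P - r) * K * B ^ (P - r)) := by
  have hP : 0 < P := hr.trans hrP
  rw [lintegral_rpow_eq_lintegral_meas_lt_mul μ (Filter.Eventually.of_forall h0)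
    hm.aemeasurable hP]
  -- Levels above B are empty, so only (0, B] contributes; there t^(P-r-1) is integrable at 0
  -- because r < P.
  have h1 : ∫⁻ t in Set.Ioi (0 : ℝ), μ {x | t < h x} * ENNReal.ofReal (t ^ (P - 1)) ≤
      ∫⁻ t in Set.Ioc (0 : ℝ) B, ENNReal.ofReal (K * t ^ (P - r - 1)) := by
    rw [← lintegral_indicator measurableSet_Ioi, ← lintegral_indicator measurableSet_Ioc]
    refine lintegral_mono fun t => ?_
    by_cases ht0 : t ∈ Set.Ioi (0 : ℝ)
    · rw [Set.indicator_of_mem ht0]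
      by_cases htB : t ≤ B
      · rw [Set.indicator_of_mem (Set.mem_Ioc.mpr ⟨ht0, htB⟩)]
        have ht0' : 0 < t := ht0
        refine (mul_le_mul_left (hweak t ht0') _).trans (le_of_eq ?_)
        rw [← ENNReal.ofReal_mul (by positivity), mul_assoc, ← Real.rpow_add ht0']
        congr 3
        ring
      · have : {x | t < h x} = ∅ := by
          ext x
          simp only [Set.mem_ofPred_eq, Set.mem_empty_iff_false, iff_false, not_lt]
          exact (hhB x).trans (not_le.mp htB).le
        rw [this]
        simp
    · rw [Set.indicator_of_notMem ht0]
      exact zero_le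
  refine (mul_le_mul_right h1 _).trans (le_of_eq ?_)
  have hint : IntervalIntegrable (fun t : ℝ => K * t ^ (P - r - 1)) volume 0 B :=
    (intervalIntegral.intervalIntegrable_rpow' (by linarith)).const_mul K
  rw [← ofReal_integral_eq_lintegral_ofReal
    ((intervalIntegrable_iff_integrableOn_Ioc_of_le hB).mp hint)
    ((ae_restrict_iff' measurableSet_Ioc).mpr (Filter.Eventually.of_forall fun t ht => by
      have := ht.1
      simp only [Pi.zero_apply]
      positivity)), ← intervalIntegral.integral_of_le hB,
    intervalIntegral.integral_const_mul, integral_rpow (Or.inl (by linarith)),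
    ← ENNReal.ofReal_mul hP.le]
  congr 1
  have e : P - r - 1 + 1 = P - r := by ring
  rw [e, Real.zero_rpow (by linarith)]
  ring

/-- Level set estimate for trigonometric polynomials, dual to a bound for the Fourier coefficients
of functions supported on the level set. -/
theorem sq_mul_sq_level_le {d : ℕ} (u : Finset (Fin d → ℤ)) (a : (Fin d → ℤ) → ℂ)
    {F : UnitAddTorus (Fin d) → ℂ} (hF : F = fun x => ∑ k ∈ u, a k * UnitAddTorus.mFourier k x)
    {α T : ℝ} (hα : 0 < α)
    (hT : ∀ g : UnitAddTorus (Fin d) → ℂ, AEStronglyMeasurable g volume →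
      (∀ x, ‖g x‖ ≤ {x | α < ‖F x‖}.indicator 1 x) →
      ∑ k ∈ u, ‖UnitAddTorus.mFourierCoeff g k‖ ^ 2 ≤ T) :
    (α * volume.real {x | α < ‖F x‖}) ^ 2 ≤ (∑ k ∈ u, ‖a k‖ ^ 2) * T := by
  have := isProbabilityMeasure_volume_unitAddTorus d
  have hFc : Continuous F := by
    rw [hF]
    exact continuous_finsetSum _ fun k _ =>
      continuous_const.mul (UnitAddTorus.mFourier k).continuous
  set E := {x | α < ‖F x‖} with hE
  have hEm : MeasurableSet E := (isOpen_lt continuous_const hFc.norm).measurableSet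
  -- The phase of F on E is the dual function: F times its conjugate is |F| on E, so the pairing is
  -- at least α|E|.
  set g : UnitAddTorus (Fin d) → ℂ := E.indicator fun x => F x / (‖F x‖ : ℂ) with hg
  have hgm : Measurable g := by
    refine Measurable.indicator ?_ hEm
    exact hFc.measurable.div (Complex.measurable_ofReal.comp hFc.norm.measurable)
  have hgE : ∀ x, ‖g x‖ ≤ E.indicator 1 x := by
    intro x
    by_cases hx : x ∈ E
    · rw [hg, Set.indicator_of_mem hx, Set.indicator_of_mem hx, norm_div, Complex.norm_real,
        norm_norm, Pi.one_apply]
      exact div_self_le_one _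
    · rw [hg, Set.indicator_of_notMem hx, Set.indicator_of_notMem hx, norm_zero]
  have hg1 : ∀ x, ‖g x‖ ≤ 1 := fun x =>
    (hgE x).trans (Set.indicator_le' (fun _ _ => le_rfl) (fun _ _ => zero_le_one) x)
  have hgint : Integrable g :=
    (memLp_top_of_bound hgm.aestronglyMeasurable 1 (Filter.Eventually.of_forall hg1)).integrable
      le_top
  have hpair : ∑ k ∈ u, a k * (starRingEnd ℂ) (UnitAddTorus.mFourierCoeff g k) =
      ∫ x, F x * (starRingEnd ℂ) (g x) := by
    simp only [hF, Finset.sum_mul, mul_assoc]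
    rw [integral_finsetSum _ fun k _ =>
      (integrable_mFourier_mul (integrable_conj hgint) k).const_mul _]
    refine Finset.sum_congr rfl fun k _ => ?_
    rw [integral_const_mul, conj_mFourierCoeff]
  have hFg : ∀ x, F x * (starRingEnd ℂ) (g x) = ((E.indicator (fun x => ‖F x‖) x : ℝ) : ℂ) := by
    intro x
    by_cases hx : x ∈ E
    · have h0 : (‖F x‖ : ℂ) ≠ 0 := by
        have : 0 < ‖F x‖ := hα.trans hx
        exact_mod_cast this.ne'
      rw [hg, Set.indicator_of_mem hx, Set.indicator_of_mem hx, map_div₀, Complex.conj_ofReal,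
        ← mul_div_assoc, Complex.mul_conj', sq, mul_div_assoc, div_self h0, mul_one]
    · rw [hg, Set.indicator_of_notMem hx, Set.indicator_of_notMem hx]
      simp
  have hFi : Integrable (fun x => E.indicator (fun x => ‖F x‖) x) := by
    refine Integrable.indicator ?_ hEm
    exact hFc.norm.integrable_of_hasCompactSupport (HasCompactSupport.of_compactSpace _)
  have hlow : α * volume.real E ≤ ‖∫ x, F x * (starRingEnd ℂ) (g x)‖ := by
    simp only [hFg]
    rw [integral_complex_ofReal, Complex.norm_real, Real.norm_eq_abs]
    refine le_trans ?_ (le_abs_self _)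
    have e : α * volume.real E = ∫ x, E.indicator (fun _ => α) x := by
      rw [integral_indicator_const _ hEm, smul_eq_mul, mul_comm]
    rw [e]
    refine integral_mono ((integrable_const α).indicator hEm) hFi fun x => ?_
    exact Set.indicator_le_indicator' fun hx => (le_of_lt hx)
  have hup : ‖∫ x, F x * (starRingEnd ℂ) (g x)‖ ≤
      ∑ k ∈ u, ‖a k‖ * ‖UnitAddTorus.mFourierCoeff g k‖ := by
    rw [← hpair]
    refine (norm_sum_le _ _).trans (le_of_eq (Finset.sum_congr rfl fun k _ => ?_))
    rw [norm_mul, RCLike.norm_conj]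
  calc (α * volume.real E) ^ 2 ≤ (∑ k ∈ u, ‖a k‖ * ‖UnitAddTorus.mFourierCoeff g k‖) ^ 2 :=
        pow_le_pow_left₀ (mul_nonneg hα.le measureReal_nonneg) (hlow.trans hup) 2
    _ ≤ (∑ k ∈ u, ‖a k‖ ^ 2) * ∑ k ∈ u, ‖UnitAddTorus.mFourierCoeff g k‖ ^ 2 :=
        Finset.sum_mul_sq_le_sq_mul_sq _ _ _
    _ ≤ _ := mul_le_mul_of_nonneg_left (hT g hgm.aestronglyMeasurable hgE)
        (Finset.sum_nonneg fun _ _ => sq_nonneg _)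

theorem norm_trigPoly_le {d : ℕ} (u : Finset (Fin d → ℤ)) (a : (Fin d → ℤ) → ℂ)
    (x : UnitAddTorus (Fin d)) :
    ‖∑ k ∈ u, a k * UnitAddTorus.mFourier k x‖ ≤
      Real.sqrt ((∑ k ∈ u, ‖a k‖ ^ 2) * u.card) := by
  refine Real.le_sqrt_of_sq_le ?_
  have h1 : ‖∑ k ∈ u, a k * UnitAddTorus.mFourier k x‖ ≤ ∑ k ∈ u, ‖a k‖ * 1 := by
    refine (norm_sum_le _ _).trans (le_of_eq (Finset.sum_congr rfl fun k _ => ?_))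
    rw [norm_mul, norm_mFourier_apply]
  have h2 := Finset.sum_mul_sq_le_sq_mul_sq u (fun k => ‖a k‖) (fun _ => (1 : ℝ))
  simp only [one_pow, Finset.sum_const, nsmul_eq_mul, mul_one] at h2 h1
  exact (pow_le_pow_left₀ (norm_nonneg _) h1 2).trans h2

theorem eLpNorm_two_eq_ofReal_sqrt {d : ℕ} {f : UnitAddTorus (Fin d) → ℂ}
    (hf : MemLp f 2 volume) :
    eLpNorm f 2 volume = ENNReal.ofReal (Real.sqrt (∫ x, ‖f x‖ ^ 2)) := by
  rw [hf.eLpNorm_eq_integral_rpow_norm (by norm_num) (by norm_num), Real.sqrt_eq_rpow]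
  simp

/-- Solving the level set inequality for the measure `e` of the level set. -/
theorem le_rpow_of_sq_mul_sq_le {α e T θ : ℝ} (hα : 0 < α) (he : 0 ≤ e) (hT : 0 ≤ T)
    (hθ1 : θ < 1) (h : (α * e) ^ 2 ≤ T * e ^ (1 + θ)) :
    e ≤ T ^ (1 / (1 - θ)) * α ^ (-(2 / (1 - θ))) := by
  rcases he.eq_or_lt with h0 | h0
  · rw [← h0]
    positivity
  have hθ : 0 < 1 - θ := by linarith
  have e1 : e ^ 2 = e ^ (1 - θ) * e ^ (1 + θ) := by
    rw [← Real.rpow_add h0, ← Real.rpow_two]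
    congr 1
    ring
  have h1 : α ^ 2 * e ^ (1 - θ) ≤ T := by
    refine le_of_mul_le_mul_right (le_trans (le_of_eq ?_) h) (Real.rpow_pos_of_pos h0 (1 + θ))
    rw [mul_pow, e1]
    ring
  have h2 : e ^ (1 - θ) ≤ T * α ^ (-2 : ℝ) := by
    rw [Real.rpow_neg hα.le, Real.rpow_two, ← div_eq_mul_inv, le_div_iff₀ (by positivity)]
    linarith
  have h3 := Real.rpow_le_rpow (by positivity) h2 (by positivity : 0 ≤ 1 / (1 - θ))
  rw [← Real.rpow_mul he, mul_one_div_cancel hθ.ne', Real.rpow_one,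
    Real.mul_rpow hT (by positivity), ← Real.rpow_mul hα.le] at h3
  refine h3.trans (le_of_eq ?_)
  congr 2
  ring

/-- The exponents of the weak-type and uniform bounds combine to the one in the theorem. -/
theorem weak_uniform_exponents {N δ C₁ C₂ M d θ r P : ℝ} (hN : 0 < N) (hδ : 0 < δ)
    (hC₁ : 0 < C₁) (hC₂ : 0 < C₂) (hM : 0 ≤ M) (hθ1 : θ < 1) (hr : r = 2 / (1 - θ)) (hrP : r < P) :
    (M * (C₁ * (N ^ (d * θ - 1) * δ))) ^ (1 / (1 - θ)) *
        Real.sqrt (M * (C₂ * (N ^ (d - 1) * δ))) ^ (P - r) =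
      C₁ ^ (r / 2) * C₂ ^ ((P - r) / 2) *
        (N ^ ((d - 1) / 2 - d / P) * δ ^ (1 / 2 : ℝ) * Real.sqrt M) ^ P := by
  have hθ : 0 < 1 - θ := by linarith
  have hr0 : 0 < r := by rw [hr]; positivity
  have hP : 0 < P := hr0.trans hrP
  have e0 : 1 / (1 - θ) = r / 2 := by rw [hr]; ring
  -- This is r(1 - θ) = 2; it makes the resulting power of N independent of θ.
  have e1 : d * θ * (r / 2) = d * (r / 2) - d := by
    rw [hr]
    field_simp
    ring
  rw [e0, Real.sqrt_eq_rpow, Real.sqrt_eq_rpow, ← Real.rpow_mul (by positivity)]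
  have e2 : 1 / 2 * (P - r) = (P - r) / 2 := by ring
  rw [e2, Real.mul_rpow hM (by positivity), Real.mul_rpow hC₁.le (by positivity),
    Real.mul_rpow (by positivity) hδ.le, Real.mul_rpow hM (by positivity),
    Real.mul_rpow hC₂.le (by positivity), Real.mul_rpow (by positivity) hδ.le,
    Real.mul_rpow (by positivity) (by positivity), Real.mul_rpow (by positivity) (by positivity),
    ← Real.rpow_mul hN.le, ← Real.rpow_mul hN.le, ← Real.rpow_mul hN.le, ← Real.rpow_mul hδ.le,
    ← Real.rpow_mul hM]
  have hMe : M ^ (1 / 2 * P) = M ^ (r / 2) * M ^ ((P - r) / 2) := by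
    rw [← Real.rpow_add_of_nonneg hM (by positivity) (by linarith)]
    congr 1
    ring
  have hδe : δ ^ (1 / 2 * P) = δ ^ (r / 2) * δ ^ ((P - r) / 2) := by
    rw [← Real.rpow_add hδ]
    congr 1
    ring
  have hNe : N ^ (((d - 1) / 2 - d / P) * P) =
      N ^ ((d * θ - 1) * (r / 2)) * N ^ ((d - 1) * ((P - r) / 2)) := by
    rw [← Real.rpow_add hN]
    congr 1
    have : (d * θ - 1) * (r / 2) = d * (r / 2) - d - r / 2 := by rw [sub_mul, e1]; ring
    rw [this]
    field_simp
    ring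
  rw [hMe, hδe, hNe]
  ring

/-! ### The spectral projector bound -/

/-- `2d/(d-4) < p ≤ ∞`; for `p = ∞` the term `d / p.toReal` is `0`, as `d/p` should be.
The constant `A` is the one implicit in `radius ∼ N` and `δ ≳ 1/N`. -/
theorem theorem1p4 (d : ℕ) (hd : 5 ≤ d) (p : ℝ≥0∞)
    (hp : ENNReal.ofReal (2 * (d : ℝ) / ((d : ℝ) - 4)) < p) (A : ℝ) (hA : 1 ≤ A) :
    ∃ C : ℝ, 0 < C ∧
      ∀ N R δ : ℝ, 1 ≤ N → N / A ≤ R → R ≤ A * N → 1 / (A * N) ≤ δ → δ ≤ 1 →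
        ∀ f : UnitAddTorus (Fin d) → ℂ, MemLp f 2 volume →
          eLpNorm (specProj R δ f) p volume ≤
            ENNReal.ofReal
                (C * N ^ (((d : ℝ) - 1) / 2 - (d : ℝ) / p.toReal) * δ ^ (1 / 2 : ℝ)) *
              eLpNorm f 2 volume := by
  have := isProbabilityMeasure_volume_unitAddTorus d
  have hd5 : (5 : ℝ) ≤ d := by exact_mod_cast hd
  have hd4 : (0 : ℝ) < d - 4 := by linarith
  obtain ⟨C₂, hC₂, hcard⟩ := exists_card_annulus_le hd hA
  have hsup : ∀ N R δ : ℝ, 1 ≤ N → N / A ≤ R → R ≤ A * N → 1 / (A * N) ≤ δ → δ ≤ 1 →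
      ∀ f : UnitAddTorus (Fin d) → ℂ, MemLp f 2 volume → ∀ x, ‖specProj R δ f x‖ ≤
        Real.sqrt ((∫ x, ‖f x‖ ^ 2) * (C₂ * (N ^ ((d : ℝ) - 1) * δ))) := by
    intro N R δ hN hR1 hR2 hδ1 hδ2 f hf x
    refine (norm_trigPoly_le _ _ x).trans (Real.sqrt_le_sqrt ?_)
    exact mul_le_mul (sum_sq_norm_mFourierCoeff_le hf _) (hcard N R δ hN hR1 hR2 hδ1 hδ2)
      (by positivity) (integral_nonneg fun _ => sq_nonneg _)
  by_cases hptop : p = ∞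
  · refine ⟨Real.sqrt C₂, Real.sqrt_pos.mpr hC₂, ?_⟩
    intro N R δ hN hR1 hR2 hδ1 hδ2 f hf
    have hN0 : 0 < N := by linarith
    have hδ0 : 0 < δ := lt_of_lt_of_le (by positivity) hδ1
    rw [eLpNorm_two_eq_ofReal_sqrt hf, ← ENNReal.ofReal_mul (by positivity), hptop,
      eLpNorm_exponent_top]
    refine eLpNormEssSup_le_of_ae_bound (Filter.Eventually.of_forall fun x =>
      (hsup N R δ hN hR1 hR2 hδ1 hδ2 f hf x).trans (le_of_eq ?_))
    have hM : 0 ≤ ∫ x, ‖f x‖ ^ 2 := integral_nonneg fun _ => sq_nonneg _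
    rw [Real.sqrt_mul hM, Real.sqrt_mul hC₂.le, Real.sqrt_mul (by positivity),
      Real.sqrt_eq_rpow δ, Real.sqrt_eq_rpow (N ^ ((d : ℝ) - 1)), ← Real.rpow_mul hN0.le]
    simp only [ENNReal.toReal_top, div_zero, sub_zero]
    have e : ((d : ℝ) - 1) * (1 / 2) = ((d : ℝ) - 1) / 2 := by ring
    rw [e]
    ring
  set P := p.toReal with hPdef
  have hpP : p = ENNReal.ofReal P := (ENNReal.ofReal_toReal hptop).symm
  have hPd : 2 * (d : ℝ) / ((d : ℝ) - 4) < P := by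
    rw [hpP] at hp
    exact (ENNReal.ofReal_lt_ofReal_iff_of_nonneg (by positivity)).mp hp
  have hP0 : 0 < P := lt_of_le_of_lt (by positivity) hPd
  -- Equivalent to P > 2d/(d-4). A θ strictly between gives dθ > 4 from the lower bound and r =
  -- 2/(1-θ) < P from the upper one.
  have hrange : 4 / (d : ℝ) < 1 - 2 / P := by
    rw [div_lt_iff₀ hd4] at hPd
    have h1 : 4 / (d : ℝ) + 2 / P < 1 := by
      rw [div_add_div _ _ (by positivity) (by positivity), div_lt_one (by positivity)]
      linarith
    linarith
  obtain ⟨θ, hθ1, hθ2⟩ := exists_between hrange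
  have hθ0 : 0 < θ := lt_trans (by positivity) hθ1
  have h2P : 0 < 2 / P := by positivity
  have hθlt : θ < 1 := by linarith
  have hdθ : 4 < d * θ := by
    rw [div_lt_iff₀ (by positivity)] at hθ1
    linarith
  obtain ⟨C₁, hC₁, hweak⟩ := exists_sum_annulus_sq_mFourierCoeff_le d hA hdθ hθ0 hθlt.le
  set r := 2 / (1 - θ) with hr
  have hr0 : 0 < r := div_pos two_pos (by linarith)
  have hrP : r < P := by
    have h1 : 2 / P < 1 - θ := by linarith
    rw [div_lt_iff₀ hP0] at h1
    rw [hr, div_lt_iff₀ (by linarith)]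
    linarith
  have hPr : 0 < P - r := by linarith
  set D := P / (P - r) * (C₁ ^ (r / 2) * C₂ ^ ((P - r) / 2)) with hD
  have hD0 : 0 < D := by positivity
  refine ⟨D ^ (1 / P), by positivity, ?_⟩
  intro N R δ hN hR1 hR2 hδ1 hδ2 f hf
  have hN0 : 0 < N := by linarith
  have hδ0 : 0 < δ := lt_of_lt_of_le (by positivity) hδ1
  set M := ∫ x, ‖f x‖ ^ 2 with hMdef
  have hM : 0 ≤ M := integral_nonneg fun _ => sq_nonneg _
  have hlev : ∀ α : ℝ, 0 < α → volume {x | α < ‖specProj R δ f x‖} ≤ ENNReal.ofReal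
      ((M * (C₁ * (N ^ (d * θ - 1) * δ))) ^ (1 / (1 - θ)) * α ^ (-r)) := by
    intro α hα
    have hcont : Continuous (specProj R δ f) := continuous_finsetSum _ fun k _ =>
      continuous_const.mul (UnitAddTorus.mFourier k).continuous
    have hEm : MeasurableSet {x | α < ‖specProj R δ f x‖} :=
      (isOpen_lt continuous_const hcont.norm).measurableSet
    have h1 := sq_mul_sq_level_le (annulus_finite d R δ).toFinset (UnitAddTorus.mFourierCoeff f)
      (F := specProj R δ f) rfl hα
      (fun g hg hgE => hweak N R δ hN hR1 hR2 hδ1 hδ2 _ hEm g hg hgE)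
    rw [← ofReal_measureReal]
    refine ENNReal.ofReal_le_ofReal (le_rpow_of_sq_mul_sq_le hα measureReal_nonneg
      (by positivity) hθlt (h1.trans ?_))
    refine (mul_le_mul_of_nonneg_right (sum_sq_norm_mFourierCoeff_le hf _)
      (by positivity)).trans (le_of_eq ?_)
    ring
  have hcont : Continuous (specProj R δ f) := continuous_finsetSum _ fun k _ =>
    continuous_const.mul (UnitAddTorus.mFourier k).continuous
  have hLp := lintegral_rpow_le_of_weak_bound hcont.norm.measurable (fun x => norm_nonneg _)
    (Real.sqrt_nonneg _) (hsup N R δ hN hR1 hR2 hδ1 hδ2 f hf) (by positivity) hr0 hrP hlev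
  rw [mul_assoc, weak_uniform_exponents hN0 hδ0 hC₁ hC₂ hM hθlt hr hrP, ← mul_assoc, ← hD] at hLp
  rw [eLpNorm_two_eq_ofReal_sqrt hf, ← ENNReal.ofReal_mul (by positivity),
    eLpNorm_eq_lintegral_rpow_enorm_toReal (by rw [hpP]; simpa using hP0) hptop, ← hPdef]
  have e : ∀ x, ‖specProj R δ f x‖ₑ ^ P = ENNReal.ofReal (‖specProj R δ f x‖ ^ P) := fun x => by
    rw [← ofReal_norm, ENNReal.ofReal_rpow_of_nonneg (norm_nonneg _) hP0.le]
  simp only [e]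
  refine (ENNReal.rpow_le_rpow hLp (by positivity)).trans (le_of_eq ?_)
  rw [ENNReal.ofReal_rpow_of_nonneg (by positivity) (by positivity),
    Real.mul_rpow hD0.le (by positivity), ← Real.rpow_mul (by positivity),
    mul_one_div_cancel hP0.ne', Real.rpow_one]
  congr 1
  ring
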